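/- Let $\mathcal D=(\mathbb R/a\mathbb Z)^2$ be a square torus of side $a>0$ with its Euclidean distance, $K\in\mathbb N$ a number of channels, and $\mathcal P(K)$ the set of nonempty subsets of $\{1,\dots,K\}$ (the classes). Fix $r\ge 0$, $\lambda>0$, $\mathcal N_0>0$, a probability distribution $(p_C)_{C\in\mathcal P(K)}$, mean file sizes $L_C>0$, and a non-increasing function $\ell:[0,\infty)\to[0,\infty)$ with $\ell(0)=1$ and $\ell(r)>0$. A user is a triple $(x,y,C)$ with $C\in\mathcal P(K)$ and $x,y\in\mathcal D$ such that the receiver $x$ lies on the circle of radius $r$ around the transmitter $y$ (that is, $x=y+r(\cos\theta,\sin\theta)$ modulo the lattice for some $\theta$). A state is a finite counting measure on users, and $\mathcal M(\mathcal D)$ is the space of finite counting measures on $\mathcal D$; both carry the $\sigma$-field generated by the evaluations on measurable sets. The multiclass spatial birth-and-death process $(\Phi_t)_{t\ge0}$ is the jump process with the following rates. Transmitters of class $C$ arrive at rate $\lambda p_C\,\mathrm dy$ on $\mathcal D$, the receiver being placed at distance $r$ in an independent uniform direction. A user $u=(x,y,C)$ of the state $\Phi$ leaves at rate $$\frac1{L_C}\,\frac{|C|\,\ell(r)}{\mathcal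 N_0+\sum_{(x',y',C')\in\Phi-\delta_u}|C\cap C'|\,\ell(\|x-y'\|)}.$$ It is built from its jump chain (which jumps from $\Phi$ with the normalised rates) and independent exponential holding times whose rate is the total rate of the current state. $\Phi^T_t\in\mathcal M(\mathcal D)$ denotes the point process of the transmitters of $\Phi_t$. Let $H$ be a Haar measure on $\mathcal D$. For a finite measure $m$ on a space $E$, let $\phi_m$ be the measure on finite counting measures on $E$ given by $$\phi_m=\sum_{n\ge0}\frac{1}{2^n\,n!}\;\bigl(m^{\otimes n}\text{ transported by }(z_1,\dots,z_n)\mapsto\delta_{z_1}+\dots+\delta_{z_n}\bigr).$$ Put $\phi=\phi_H$, and $\psi=\phi_{\nu}$, where $\nu$ is the measure on users under which the transmitter has distribution $H$, with independent uniform direction of the link and independent class of law $(p_C)$. Then, for all such parameters: 1. From every initial state the jump times are almost surely strictly increasing to $\infty$, and $(\Phi_t)_{t\ge 0}$ is a time-homogeneous Markov jump process: it starts from the given state, its paths are almost surely right-continuous step functions with finitely many jumps in bounded time, and it has the Markov property with respect to its own past. 2. $\phi(\{0\})=1$, and for all $n$ and all disjoint Borel sets $B_1,\dots,B_n\subseteq\mathcal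 D$, $\phi(\{\Phi:\Phi(\mathcal D)=n,\ \Phi(B_1)>0,\dots,\Phi(B_n)>0\})=2^{-n}H(B_1)\cdots H(B_n)$. The image of $\psi$ under the map to transmitters is $\phi$. 3. $(\Phi_t)$ is $\psi$-irreducible: for every measurable set $A$ of states with $\psi(A)>0$ and every initial state, $\int_0^\infty\mathbb P(\Phi_t\in A)\,\mathrm dt>0$. In particular it is $\phi$-irreducible on $\mathcal M(\mathcal D)$: for every measurable $A\subseteq\mathcal M(\mathcal D)$ with $\phi(A)>0$ and every initial state, $\int_0^\infty\mathbb P(\Phi^T_t\in A)\,\mathrm dt>0$. 4. The same holds for the jump chain: from every initial state (in particular from the empty one), every measurable set of states with positive $\psi$-measure, and every set $\{\Phi:\Phi^T\in A\}$ with $A\subseteq\mathcal M(\mathcal D)$ measurable and $\phi(A)>0$, is reached with positive probability in some number of steps. In particular the empty configuration is reached with positive probability in some number of steps from every state. -/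

import Mathlib

open MeasureTheory ProbabilityTheory Set Filter Topology
open scoped ENNReal NNReal

noncomputable section

namespace SBD

/-! ## Counting measures

A finite counting measure `∑ᵢ δ_{xᵢ}` on `E` is represented by the multiset of its atoms.  The
`σ`-field is the usual one, generated by the evaluations `s ↦ s(B)` for measurable `B`.  (On a
compact space every locally finite counting measure is finite.) -/

section Config

variable {E F : Type*} [MeasurableSpace E] [MeasurableSpace F]

/-- Finite counting measures on `E`, as multisets of atoms. -/
abbrev Config (E : Type*) := Multiset E

/-- The measure `∑_{x ∈ s} δ_x`. -/
def toMeasure (s : Config E) : Measure E := (s.map Measure.dirac).sum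

instance instMeasurableSpaceConfig : MeasurableSpace (Config E) :=
  MeasurableSpace.comap toMeasure inferInstance

@[simp] lemma toMeasure_zero : toMeasure (0 : Config E) = 0 := by simp [toMeasure]

@[simp] lemma toMeasure_cons (u : E) (s : Config E) :
    toMeasure (u ::ₘ s) = Measure.dirac u + toMeasure s := by simp [toMeasure]

lemma measurable_toMeasure : Measurable (toMeasure : Config E → Measure E) :=
  comap_measurable _

lemma measurable_config_iff {α : Type*} [MeasurableSpace α] {f : α → Config E} :
    Measurable f ↔ ∀ B, MeasurableSet B → Measurable fun a => toMeasure (f a) B := by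
  rw [measurable_comap_iff]
  exact ⟨fun h B hB => (Measure.measurable_coe hB).comp h,
    fun h => Measure.measurable_of_measurable_coe _ h⟩

lemma lintegral_toMeasure (s : Config E) {f : E → ℝ≥0∞} (hf : Measurable f) :
    ∫⁻ x, f x ∂toMeasure s = (s.map f).sum := by
  induction s using Multiset.induction_on with
  | empty => simp
  | cons u s ih => simp [lintegral_add_measure, ih, lintegral_dirac' _ hf]

lemma toMeasure_univ (s : Config E) : toMeasure s univ = (Multiset.card s : ℝ≥0∞) := by
  induction s using Multiset.induction_on with
  | empty => simp
  | cons u s ih => simp [ih, add_comm]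

open scoped Classical in
lemma toMeasure_singleton [MeasurableSingletonClass E] (s : Config E) (u : E) :
    toMeasure s {u} = (s.count u : ℝ≥0∞) := by
  induction s using Multiset.induction_on with
  | empty => simp
  | cons v s ih =>
    by_cases h : u = v
    · subst h; simp [ih, add_comm]
    · simp [ih, Multiset.count_cons_of_ne h, Ne.symm h]

/-- A multiset and its counting measure carry the same information. -/
lemma toMeasure_injective [MeasurableSingletonClass E] :
    Function.Injective (toMeasure : Config E → Measure E) := by
  classical
  intro s t h
  ext u
  have := congrArg (fun μ : Measure E => μ {u}) h
  simpa [toMeasure_singleton] using this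

/-- `s ↦ ∑_{x ∈ s} δ_x` as a kernel. -/
def countingKernel : Kernel (Config E) E := ⟨toMeasure, measurable_toMeasure⟩

lemma countingKernel_apply (s : Config E) : countingKernel s = toMeasure s := rfl

lemma measurable_card : Measurable fun s : Config E => Multiset.card s := by
  have h : Measurable fun s : Config E => toMeasure s univ :=
    (Measure.measurable_coe MeasurableSet.univ).comp measurable_toMeasure
  simp only [toMeasure_univ] at h
  have h2 : Measurable fun s : Config E => ((Multiset.card s : ℝ≥0∞)).toReal := h.ennreal_toReal
  simp only [ENNReal.toReal_natCast] at h2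
  refine measurable_to_countable' fun n => ?_
  convert! h2 (measurableSet_singleton (n : ℝ)) using 1
  ext s; simp

instance : IsSFiniteKernel (countingKernel (E := E)) := by
  classical
  have hm (n : ℕ) : MeasurableSet {s : Config E | Multiset.card s = n} :=
    measurable_card (measurableSet_singleton n)
  refine ⟨⟨fun n => Kernel.piecewise (hm n) countingKernel 0, fun n => ⟨⟨n, by simp, ?_⟩⟩, ?_⟩⟩
  · intro s
    rw [Kernel.piecewise_apply]
    split_ifs with h
    · rw [countingKernel_apply, toMeasure_univ]; simp_all
    · simp
  · ext s B hB
    rw [Kernel.sum_apply' _ _ hB, tsum_eq_single (Multiset.card s)]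
    · simp [Kernel.piecewise_apply]
    · intro n hn
      simp [Kernel.piecewise_apply, hn.symm]

lemma measurable_sum_map {α : Type*} [MeasurableSpace α] {f : α → E → ℝ≥0∞}
    (hf : Measurable (Function.uncurry f)) {g : α → Config E} (hg : Measurable g) :
    Measurable fun a => ((g a).map (f a)).sum := by
  have h : Measurable fun a => ∫⁻ x, f a x ∂(countingKernel.comap g hg a) :=
    Measurable.lintegral_kernel_prod_right (κ := countingKernel.comap g hg) hf
  convert h using 2 with a
  rw [Kernel.comap_apply, countingKernel_apply, lintegral_toMeasure]
  exact hf.comp measurable_prodMk_left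

lemma measurable_cons : Measurable fun q : E × Config E => q.1 ::ₘ q.2 := by
  refine measurable_config_iff.2 fun B hB => ?_
  simp only [toMeasure_cons, Measure.add_apply, Measure.dirac_apply' _ hB]
  exact ((measurable_one.indicator hB).comp measurable_fst).add
    ((Measure.measurable_coe hB).comp (measurable_toMeasure.comp measurable_snd))

lemma measurable_cons_right (s : Config E) : Measurable fun u : E => u ::ₘ s :=
  measurable_cons.comp (measurable_id.prodMk measurable_const)

open scoped Classical in
lemma measurable_erase [MeasurableEq E] :
    Measurable fun q : E × Config E => q.2.erase q.1 := by
  have hmem : MeasurableSet {q : E × Config E | q.1 ∈ q.2} := by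
    have h : Measurable fun q : E × Config E =>
        (q.2.map fun x => ({y : E × E | y.1 = y.2}.indicator 1 (q.1, x) : ℝ≥0∞)).sum :=
      measurable_sum_map (f := fun (q : E × Config E) (x : E) =>
          ({y : E × E | y.1 = y.2}.indicator 1 (q.1, x) : ℝ≥0∞))
        ((measurable_one.indicator measurableSet_diagonal).comp
          ((measurable_fst.comp measurable_fst).prodMk measurable_snd)) measurable_snd
    convert! h (measurableSet_singleton 0).compl using 1
    ext q
    simp [Multiset.sum_eq_zero_iff, indicator_apply]
  have key (q : E × Config E) (h : q.1 ∈ q.2) (B : Set E) (hB : MeasurableSet B) :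
      toMeasure (q.2.erase q.1) B = toMeasure q.2 B - B.indicator 1 q.1 := by
    conv_rhs => rw [← Multiset.cons_erase h]
    rw [toMeasure_cons, Measure.add_apply, Measure.dirac_apply' _ hB]
    rw [ENNReal.add_sub_cancel_left]
    by_cases hq : q.1 ∈ B <;> simp [hq]
  refine measurable_config_iff.2 fun B hB => ?_
  have hms : Measurable fun q : E × Config E => toMeasure q.2 B :=
    (Measure.measurable_coe hB).comp (measurable_toMeasure.comp measurable_snd)
  have h2 : Measurable fun q : E × Config E => if q.1 ∈ q.2 then
      toMeasure q.2 B - B.indicator 1 q.1 else toMeasure q.2 B :=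
    Measurable.ite hmem (hms.sub ((measurable_one.indicator hB).comp measurable_fst)) hms
  convert h2 using 2 with q
  split_ifs with h
  · exact key q h B hB
  · rw [Multiset.erase_of_notMem h]

/-- The measure `∑_{n ≥ 0} 2⁻ⁿ (n!)⁻¹ · (law of δ_{x₁} + ⋯ + δ_{xₙ} under m(dx₁)⋯m(dxₙ))` on
counting measures.  It charges the set of counting measures with exactly one atom in each of the
disjoint sets `B₁, …, Bₙ` and no other atom by `2⁻ⁿ m(B₁)⋯m(Bₙ)`. -/
def referenceMeasure (m : Measure E) : Measure (Config E) :=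
  Measure.sum fun n : ℕ => ((2 : ℝ≥0∞)⁻¹ ^ n * (n.factorial : ℝ≥0∞)⁻¹) •
    (Measure.pi fun _ : Fin n => m).map fun x => Finset.univ.val.map x

/-- The counting measures with `n` atoms in all that charge every one of `B₁, …, Bₙ`. -/
def oneInEach {n : ℕ} (B : Fin n → Set E) : Set (Config E) :=
  {s | toMeasure s univ = n ∧ ∀ i, 0 < toMeasure s (B i)}

end Config

/-! ## Jump processes from a rate kernel -/

section Jump

variable {E : Type*} [MeasurableSpace E]

/-- The jump chain of a rate kernel `q`: from `x` jump to `q(x, ·) / q(x, E)`. -/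
def jumpKernel (q : Kernel E E) : Kernel E E where
  toFun x := (q x univ)⁻¹ • q x
  measurable' := Measure.measurable_of_measurable_coe _ fun A hA => by
    simp only [Measure.smul_apply, smul_eq_mul]
    exact (q.measurable_coe MeasurableSet.univ).inv.mul (q.measurable_coe hA)

/-- Every state has a finite and positive total jump rate. -/
class IsPosFiniteRate (q : Kernel E E) : Prop where
  pos : ∀ x, q x univ ≠ 0
  finite : ∀ x, q x univ ≠ ∞

instance (q : Kernel E E) [h : IsPosFiniteRate q] : IsMarkovKernel (jumpKernel q) :=
  ⟨fun x => ⟨by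
    change (q x univ)⁻¹ * q x univ = 1
    exact ENNReal.inv_mul_cancel (h.pos x) (h.finite x)⟩⟩

instance : IsProbabilityMeasure (expMeasure 1) := isProbabilityMeasure_expMeasure one_pos

/-- A path: the successive states, and one exponential clock of rate `1` for each of them. -/
abbrev JumpPath (E : Type*) := (ℕ → E) × (ℕ → ℝ)

/-- Law of the Markov chain with transition kernel `κ`, as a function of the initial state. -/
def chainLaw (κ : Kernel E E) [IsMarkovKernel κ] : Kernel E (ℕ → E) :=
  (Kernel.traj (X := fun _ => E)
    (fun n => κ.comap (fun h : (Π _ : Finset.Iic n, E) => h ⟨n, by simp⟩)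
      (measurable_pi_apply _)) 0).comap (fun x _ => x) (by fun_prop)

/-- Law of the path started at `x`: the jump chain, and independent of it an i.i.d. sequence of
exponential clocks with mean `1`. -/
def pathLaw (q : Kernel E E) [IsPosFiniteRate q] : Kernel E (JumpPath E) :=
  (chainLaw (jumpKernel q)) ×ₖ Kernel.const E (Measure.infinitePi fun _ : ℕ => expMeasure 1)

/-- Time of the `n`-th jump.  The `k`-th state `x` is held during the `k`-th clock divided by
`q(x, E)`, that is, for an exponential time of rate `q(x, E)`. -/
def jumpTime (q : Kernel E E) (ω : JumpPath E) (n : ℕ) : ℝ :=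
  ∑ k ∈ Finset.range n, ω.2 k / (q (ω.1 k) univ).toReal

/-- State at time `t`: the state number `n`, where `T_n ≤ t < T_{n+1}`.  (The default value in case
all the jump times are `≤ t` plays no role for a process that does not explode.) -/
def jumpProcess (q : Kernel E E) (t : ℝ≥0) (ω : JumpPath E) : E :=
  ω.1 (sInf {n | (t : ℝ) < jumpTime q ω (n + 1)})

end Jump

section Markov

variable {E F Ω : Type*} [MeasurableSpace E] [MeasurableSpace F] [MeasurableSpace Ω]

/-- `Φ` is, under the laws `P x`, a time-homogeneous Markov jump process on `E`: it starts from
`x`, its paths are right-continuous step functions with finitely many jumps in bounded time, and it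
has the Markov property for its own past. -/
structure IsMarkovJumpProcess (P : Kernel E Ω) (Φ : ℝ≥0 → Ω → E) : Prop where
  isMarkovKernel : IsMarkovKernel P
  measurable : ∀ t, Measurable (Φ t)
  start : ∀ x, ∀ᵐ ω ∂P x, Φ 0 ω = x
  step : ∀ x, ∀ᵐ ω ∂P x, ∃ T : ℕ → ℝ≥0, T 0 = 0 ∧ Monotone T ∧ Tendsto T atTop atTop ∧
    ∀ n, ∀ t ∈ Ico (T n) (T (n + 1)), Φ t ω = Φ (T n) ω
  markov : ∀ x (s t : ℝ≥0) (A : Set E), MeasurableSet A →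
    (P x)⟦Φ (s + t) ⁻¹' A | ⨆ u ∈ Iic s, MeasurableSpace.comap (Φ u) inferInstance⟧
      =ᵐ[P x] fun ω => (P (Φ s ω)).real (Φ t ⁻¹' A)

/-- `φ`-irreducibility in continuous time: from every initial state, every set of positive
`φ`-measure has positive expected occupation time. -/
def IsPhiIrreducible (P : Kernel E Ω) (Y : ℝ≥0 → Ω → F) (φ : Measure F) : Prop :=
  ∀ A, MeasurableSet A → 0 < φ A → ∀ x, 0 < ∫⁻ t in Ici (0 : ℝ), P x {ω | Y t.toNNReal ω ∈ A}

end Markov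

/-! ## The network -/

/-- The square torus of side `a`. -/
abbrev Torus (a : ℝ) := AddCircle a × AddCircle a

/-- Euclidean distance on the square torus. -/
def torusDist {a : ℝ} (x y : Torus a) : ℝ≥0 :=
  NNReal.sqrt (‖x.1 - y.1‖₊ ^ 2 + ‖x.2 - y.2‖₊ ^ 2)

/-- The classes: nonempty sets of channels. -/
abbrev Class (K : ℕ) := {C : Finset (Fin K) // C.Nonempty}

/-- The parameters of the network with `K` channels. -/
structure Network (K : ℕ) where
  /-- side of the square torus -/
  side : ℝ
  side_pos : 0 < side
  /-- distance `r` between the receiver and the transmitter of a user -/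
  linkLength : ℝ≥0
  /-- path-loss function `ℓ` -/
  pathLoss : ℝ≥0 → ℝ≥0
  pathLoss_antitone : Antitone pathLoss
  pathLoss_zero : pathLoss 0 = 1
  pathLoss_linkLength_pos : 0 < pathLoss linkLength
  /-- intensity `λ` of arrivals per unit of area and time -/
  arrivalRate : ℝ≥0
  arrivalRate_pos : 0 < arrivalRate
  /-- thermal noise -/
  noise : ℝ≥0
  noise_pos : 0 < noise
  /-- class of an arriving user -/
  classProb : Class K → ℝ≥0
  sum_classProb : ∑ C, classProb C = 1
  /-- mean file size of each class -/
  meanFile : Class K → ℝ≥0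
  meanFile_pos : ∀ C, 0 < meanFile C

namespace Network

variable {K : ℕ} (N : Network K)

instance : Fact (0 < N.side) := ⟨N.side_pos⟩

/-- The vector of length `r` and direction `θ`, modulo the lattice. -/
def link (θ : ℝ) : Torus N.side :=
  (((N.linkLength * Real.cos θ : ℝ) : AddCircle N.side),
    ((N.linkLength * Real.sin θ : ℝ) : AddCircle N.side))

/-- Pairs (receiver, transmitter) whose receiver lies on the circle of radius `r` around the
transmitter. -/
abbrev Dipole := {d : Torus N.side × Torus N.side // ∃ θ : ℝ, d.1 = d.2 + N.link θ}

/-- A user: a receiver-transmitter pair and a class. -/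
abbrev User := N.Dipole × Class K

/-- location of the receiver -/
def receiver (u : N.User) : Torus N.side := u.1.1.1

/-- location of the transmitter -/
def transmitter (u : N.User) : Torus N.side := u.1.1.2

/-- the point process of the transmitters -/
def transmitters (s : Config N.User) : Config (Torus N.side) := s.map N.transmitter

/-- The user with transmitter at `y`, receiver in direction `θ` from `y`, and class `C`. -/
def mkUser (q : Torus N.side × ℝ × Class K) : N.User :=
  (⟨(q.1 + N.link q.2.1, q.1), q.2.1, rfl⟩, q.2.2)

/-- Distribution of the class of an arriving user. -/
def classLaw : Measure (Class K) := ∑ C, (N.classProb C : ℝ≥0∞) • Measure.dirac C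

/-- Users with transmitter distributed according to `H`, independent uniform direction of the link,
and independent class. -/
def userMeasure (H : Measure (Torus N.side)) : Measure N.User :=
  (H.prod ((volume[|Ico 0 (2 * Real.pi)]).prod N.classLaw)).map N.mkUser

/-- Interference at the receiver of `u` caused by the other users `s`. -/
def interference (u : N.User) (s : Config N.User) : ℝ≥0 :=
  (s.map fun v => ((u.2.1 ∩ v.2.1).card : ℝ≥0) *
    N.pathLoss (torusDist (N.receiver u) (N.transmitter v))).sum

/-- Departure rate `R / L_C` of a user `u` of class `C` in the presence of the other users `s`,
where `R = |C| ℓ(r) / (noise + interference)`. -/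
def deathRate (u : N.User) (s : Config N.User) : ℝ≥0 :=
  (u.2.1.card * N.pathLoss N.linkLength / (N.noise + N.interference u s)) / N.meanFile u.2

lemma measurable_interference :
    Measurable fun q : N.User × Config N.User => N.interference q.1 q.2 := by
  have hr : Measurable N.receiver :=
    measurable_fst.comp (measurable_subtype_coe.comp measurable_fst)
  have ht : Measurable N.transmitter :=
    measurable_snd.comp (measurable_subtype_coe.comp measurable_fst)
  have hd : Measurable fun q : Torus N.side × Torus N.side => torusDist q.1 q.2 := by
    unfold torusDist
    have : Continuous fun q : Torus N.side × Torus N.side =>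
        NNReal.sqrt (‖q.1.1 - q.2.1‖₊ ^ 2 + ‖q.1.2 - q.2.2‖₊ ^ 2) := by fun_prop
    exact this.measurable
  have hc : Measurable fun c : Class K × Class K => ((c.1.1 ∩ c.2.1).card : ℝ≥0) :=
    measurable_of_countable _
  have hf : Measurable (Function.uncurry fun (q : N.User × Config N.User) (v : N.User) =>
      (((((q.1.2.1 ∩ v.2.1).card : ℝ≥0) *
        N.pathLoss (torusDist (N.receiver q.1) (N.transmitter v)) : ℝ≥0)) : ℝ≥0∞)) := by
    refine Measurable.coe_nnreal_ennreal (Measurable.mul ?_ ?_)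
    · exact hc.comp (f := fun p : (N.User × Config N.User) × N.User => (p.1.1.2, p.2.2))
        (by fun_prop)
    · refine N.pathLoss_antitone.measurable.comp ?_
      exact hd.comp (f := fun p : (N.User × Config N.User) × N.User =>
        (N.receiver p.1.1, N.transmitter p.2)) (by fun_prop)
  have h := (measurable_sum_map hf measurable_snd).ennreal_toNNReal
  convert h using 2 with q
  rw [← ENNReal.toNNReal_coe (N.interference q.1 q.2)]
  congr 1
  change ENNReal.ofNNRealHom _ = _
  rw [interference, map_multiset_sum, Multiset.map_map]
  rfl

lemma measurable_deathRate :
    Measurable fun q : N.User × Config N.User => N.deathRate q.1 q.2 := by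
  have h1 : Measurable fun C : Class K => (C.1.card : ℝ≥0) := measurable_of_countable _
  have h2 : Measurable N.meanFile := measurable_of_countable _
  have h3 := N.measurable_interference
  unfold deathRate
  refine Measurable.div (Measurable.div (Measurable.mul ?_ measurable_const)
    (measurable_const.add h3)) ?_
  · exact h1.comp (measurable_snd.comp measurable_fst)
  · exact h2.comp (measurable_snd.comp measurable_fst)

lemma measurable_mkUser : Measurable N.mkUser := by
  have hl : Measurable N.link := by
    have hm : Measurable ((↑) : ℝ → AddCircle N.side) := AddCircle.measurable_mk'
    exact (hm.comp (by fun_prop)).prodMk (hm.comp (by fun_prop))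
  refine Measurable.prodMk (Measurable.subtype_mk ?_) (by fun_prop)
  exact (measurable_fst.add (hl.comp (by fun_prop))).prodMk measurable_fst

instance : IsProbabilityMeasure N.classLaw := ⟨by
  have h := N.sum_classProb
  simp only [classLaw, Measure.coe_finsetSum, Finset.sum_apply, Measure.smul_apply,
    measure_univ, smul_eq_mul, mul_one]
  exact_mod_cast h⟩

instance : IsProbabilityMeasure (volume[|Ico 0 (2 * Real.pi)]) :=
  cond_isProbabilityMeasure_of_finite (by simp [Real.pi_pos])
    (by rw [Real.volume_Ico]; exact ENNReal.ofReal_ne_top)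

lemma userMeasure_univ (H : Measure (Torus N.side)) [SFinite H] :
    N.userMeasure H univ = H univ := by
  rw [userMeasure, Measure.map_apply N.measurable_mkUser MeasurableSet.univ, preimage_univ,
    ← univ_prod_univ, Measure.prod_prod,
    measure_univ (μ := (volume[|Ico 0 (2 * Real.pi)]).prod N.classLaw), mul_one]

instance (H : Measure (Torus N.side)) [IsFiniteMeasure H] : IsFiniteMeasure (N.userMeasure H) :=
  ⟨by rw [userMeasure_univ]; exact measure_lt_top _ _⟩

instance : MeasurableEq N.User := ⟨by
  have hv : Measurable fun u : N.User => u.1.1 := measurable_subtype_coe.comp measurable_fst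
  have h1 : MeasurableSet {q : N.User × N.User | q.1.1.1.1 = q.2.1.1.1} :=
    measurableSet_eq_fun (measurable_fst.comp (hv.comp measurable_fst))
      (measurable_fst.comp (hv.comp measurable_snd))
  have h1b : MeasurableSet {q : N.User × N.User | q.1.1.1.2 = q.2.1.1.2} :=
    measurableSet_eq_fun (measurable_snd.comp (hv.comp measurable_fst))
      (measurable_snd.comp (hv.comp measurable_snd))
  have h2 : MeasurableSet {q : N.User × N.User | q.1.2 = q.2.2} :=
    measurableSet_eq_fun (measurable_snd.comp measurable_fst) (measurable_snd.comp measurable_snd)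
  convert! (h1.inter h1b).inter h2 using 1
  ext ⟨u, v⟩
  simp only [mem_diagonal_iff, mem_inter_iff, mem_ofPred_eq]
  rw [Prod.ext_iff, Subtype.ext_iff, Prod.ext_iff]⟩

lemma sum_smul_dirac_apply {E F : Type*} [MeasurableSpace F] (s : Multiset E) (c : E → ℝ≥0∞)
    (g : E → F) {A : Set F} (hA : MeasurableSet A) :
    (s.map fun u => c u • Measure.dirac (g u)).sum A
      = (s.map fun u => c u * A.indicator 1 (g u)).sum := by
  induction s using Multiset.induction_on with
  | empty => simp
  | cons u s ih => simp [ih, Measure.dirac_apply' _ hA]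

open scoped Classical in
/-- The jump rates of the spatial birth-and-death process: users arrive at rate `λ dy` with
uniform direction and class of law `p`, and each user `u` of `s` leaves at rate
`deathRate u (s - δ_u)`. -/
def rateKernel : Kernel (Config N.User) (Config N.User) where
  toFun s := ((N.arrivalRate : ℝ≥0∞) • N.userMeasure volume).map (fun u => u ::ₘ s) +
    (s.map fun u => (N.deathRate u (s.erase u) : ℝ≥0∞) • Measure.dirac (s.erase u)).sum
  measurable' := by
    refine Measure.measurable_of_measurable_coe _ fun A hA => ?_
    simp only [Measure.add_apply]
    refine Measurable.add ?_ ?_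
    · have h : Measurable fun s : Config N.User =>
          ((N.arrivalRate : ℝ≥0∞) • N.userMeasure volume) ((fun u => (u, s)) ⁻¹'
            ((fun q : N.User × Config N.User => q.1 ::ₘ q.2) ⁻¹' A)) := by
        have hfin : IsFiniteMeasure ((N.arrivalRate : ℝ≥0∞) • N.userMeasure volume) :=
          Measure.smul_finite _ ENNReal.coe_ne_top
        exact measurable_measure_prodMk_right (measurable_cons hA)
      convert h using 2 with s
      rw [Measure.map_apply (measurable_cons_right s) hA]
      rfl
    · simp only [sum_smul_dirac_apply _ _ _ hA]
      have he : Measurable fun p : Config N.User × N.User => p.1.erase p.2 :=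
        measurable_erase.comp measurable_swap
      refine measurable_sum_map (f := fun (s : Config N.User) (u : N.User) =>
        (N.deathRate u (s.erase u) : ℝ≥0∞) * A.indicator 1 (s.erase u)) ?_ measurable_id
      exact (N.measurable_deathRate.comp (measurable_snd.prodMk he)).coe_nnreal_ennreal.mul
        ((measurable_one.indicator hA).comp he)

lemma rateKernel_univ (s : Config N.User) : ∃ d : ℝ≥0, N.rateKernel s univ =
    N.arrivalRate * (volume : Measure (Torus N.side)) univ + d := by
  classical
  refine ⟨(s.map fun u => N.deathRate u (s.erase u)).sum, ?_⟩
  change (Measure.map _ _ + _ : Measure _) univ = _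
  rw [Measure.add_apply, sum_smul_dirac_apply _ _ _ MeasurableSet.univ,
    Measure.map_apply (measurable_cons_right s) MeasurableSet.univ,
    preimage_univ, Measure.smul_apply, userMeasure_univ, smul_eq_mul]
  congr 1
  change _ = ENNReal.ofNNRealHom _
  rw [map_multiset_sum, Multiset.map_map]
  simp only [indicator_univ, Pi.one_apply, mul_one]
  rfl

instance : IsPosFiniteRate N.rateKernel where
  pos s := by
    obtain ⟨d, hd⟩ := N.rateKernel_univ s
    have h := N.arrivalRate_pos.ne'
    have hv : (volume : Measure (Torus N.side)) univ ≠ 0 := NeZero.ne _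
    simp [hd, h, hv]
  finite s := by
    obtain ⟨d, hd⟩ := N.rateKernel_univ s
    rw [hd]
    exact ENNReal.add_ne_top.2
      ⟨ENNReal.mul_ne_top ENNReal.coe_ne_top (measure_ne_top _ _), ENNReal.coe_ne_top⟩

end Network

end SBD

end

open SBD

/-! Three mechanisms carry the theorem.

Non-explosion. A jump adds at most one user, and interference only slows departures, so every
departure rate is below `maxDeathRate` and the total rate along the jump chain is at most `C * (k +
1)`. The jump times therefore dominate `C⁻¹ ∑ e k / (k + 1)` with i.i.d. unit exponential clocks.
This sum diverges almost surely: the Laplace transform of its partial sums telescopes to `1 / (n +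
1)` (`ae_tendsto_sum_clocks`, `SBD.ae_isRegularPath`).

Markov property. On the event of exactly `n` jumps by time `s`, the past is a function of the first
`n + 1` states and `n` clocks. The path seen from `s` has, given these, the law of a fresh path from
the current state: for `n = 0` this is the memoryless property, and the first-jump decomposition
`lintegral_pathLaw` carries it from `n` to `n + 1` (`lintegral_restart`). Summing over `n` gives the
conditional probability (`measure_past_inter`, `condExp_jumpProcess`).

Irreducibility. Every user leaves at a positive rate, so departures alone lead from `s` to the empty
state in `card s` steps. From there `n` successive births produce a law that dominates `n`
independent users, because `H` and `volume` have the same null sets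
(`map_pi_absolutelyContinuous_pow`). A set charged by the reference measure is charged by one of its
terms, hence reached by the chain (`exists_jumpKernel_pow_pos`). Each visited state is held for a
time of positive length, which gives positive occupation in continuous time. Mapping users to
transmitters transfers everything to the torus. -/

noncomputable section

namespace SBD

/-! ### First-step decompositions of Markov chains and i.i.d. sequences. -/

section Sequences

variable {E : Type*}

/-- The sequence `x, y 0, y 1, …`. -/
def consSeq (x : E) (y : ℕ → E) : ℕ → E
  | 0 => x
  | n + 1 => y n

@[simp] lemma consSeq_zero (x : E) (y : ℕ → E) : consSeq x y 0 = x := rfl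

@[simp] lemma consSeq_succ (x : E) (y : ℕ → E) (n : ℕ) : consSeq x y (n + 1) = y n := rfl

variable [MeasurableSpace E]

lemma measurable_consSeq : Measurable fun p : E × (ℕ → E) => consSeq p.1 p.2 := by
  refine measurable_pi_lambda _ fun n => ?_
  cases n with
  | zero => exact measurable_fst
  | succ n => exact (measurable_pi_apply n).comp measurable_snd

/-- Indicators of square cylinders are such products, with factor `1` at the unconstrained
coordinates, and these cylinders form a generating π-system. Products over initial segments are the
form suited to induction on time. -/
lemma measure_ext_of_lintegral_prod {μ ν : Measure (ℕ → E)} [IsProbabilityMeasure μ]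
    [IsProbabilityMeasure ν]
    (h : ∀ (n : ℕ) (f : ℕ → E → ℝ≥0∞), (∀ i, Measurable (f i)) →
      ∫⁻ ω, ∏ i ∈ Finset.range n, f i (ω i) ∂μ = ∫⁻ ω, ∏ i ∈ Finset.range n, f i (ω i) ∂ν) :
    μ = ν := by
  classical
  refine ext_of_generate_finite (squareCylinders fun _ : ℕ => {s : Set E | MeasurableSet s})
    generateFrom_squareCylinders.symm
    (isPiSystem_squareCylinders (fun _ => MeasurableSpace.isPiSystem_measurableSet)
      fun _ => MeasurableSet.univ)
    ?_ (by simp)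
  rintro _ ⟨s, t, ht, rfl⟩
  have ht' (i : ℕ) : MeasurableSet (t i) := ht i (mem_univ i)
  obtain ⟨n, hn⟩ := s.exists_nat_subset_range
  have hm : MeasurableSet ((s : Set ℕ).pi t) :=
    MeasurableSet.pi s.countable_toSet fun i _ => ht' i
  have key : ((s : Set ℕ).pi t).indicator (1 : (ℕ → E) → ℝ≥0∞) = fun ω =>
      ∏ i ∈ Finset.range n, (if i ∈ s then (t i).indicator 1 else 1 : E → ℝ≥0∞) (ω i) := by
    ext ω
    by_cases hω : ω ∈ (s : Set ℕ).pi t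
    · rw [indicator_of_mem hω, Finset.prod_eq_one]
      · rfl
      · intro i _
        split_ifs with hi
        · exact indicator_of_mem (hω i hi) _
        · rfl
    · rw [indicator_of_notMem hω]
      obtain ⟨i, hi, hit⟩ : ∃ i ∈ s, ω i ∉ t i := by simpa [Set.mem_pi] using hω
      exact (Finset.prod_eq_zero (hn hi) (by simp [hi, hit])).symm
  rw [← lintegral_indicator_one hm, ← lintegral_indicator_one hm, key]
  refine h n _ fun i => ?_
  split_ifs
  · exact measurable_one.indicator (ht' i)
  · exact measurable_one

variable (κ : Kernel E E) [IsMarkovKernel κ]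

instance : IsMarkovKernel (chainLaw κ) := by unfold chainLaw; infer_instance

/-- A trajectory is built by appending states at its end, so the last state is the one that can be
integrated out directly. -/
lemma lintegral_chainLaw_prod_succ (n : ℕ) (f : ℕ → E → ℝ≥0∞) (hf : ∀ i, Measurable (f i))
    (x : E) :
    ∫⁻ ω, ∏ i ∈ Finset.range (n + 2), f i (ω i) ∂chainLaw κ x =
      ∫⁻ ω, (∏ i ∈ Finset.range (n + 1), f i (ω i)) * ∫⁻ y, f (n + 1) y ∂κ (ω n)
        ∂chainLaw κ x := by
  set κ' : (n : ℕ) → Kernel (Π _ : Finset.Iic n, E) E :=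
    fun n => κ.comap (fun h : (Π _ : Finset.Iic n, E) => h ⟨n, by simp⟩)
      (measurable_pi_apply _) with hκ'
  have h := Kernel.partialTraj_compProd_eq_map_traj (X := fun _ => E) (κ := κ') (Nat.zero_le n)
    (x₀ := fun _ => x)
  rw [← Kernel.traj_map_frestrictLe_apply] at h
  have hm : Measurable fun p : (Π _ : Finset.Iic n, E) × E =>
      (∏ i : Finset.Iic n, f i (p.1 i)) * f (n + 1) p.2 := by
    refine Measurable.mul (Finset.measurable_prod _ fun i _ => ?_) ?_
    · exact (hf _).comp ((measurable_pi_apply i).comp measurable_fst)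
    · exact (hf _).comp measurable_snd
  have h2 := congrArg (fun μ => ∫⁻ p, (∏ i : Finset.Iic n, f i (p.1 i)) * f (n + 1) p.2 ∂μ) h
  beta_reduce at h2
  rw [Measure.lintegral_compProd hm, lintegral_map hm (by fun_prop),
    lintegral_map hm.lintegral_kernel_prod_right' (by fun_prop)] at h2
  have hprod (ω : ℕ → E) : ∏ i : Finset.Iic n, f i (Preorder.frestrictLe n ω i) =
      ∏ i ∈ Finset.range (n + 1), f i (ω i) := by
    refine (Finset.prod_coe_sort (Finset.Iic n) fun i => f i (ω i)).trans ?_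
    congr 1
    ext; simp
  simp only [hprod] at h2
  change ∫⁻ ω, _ ∂(Kernel.traj (X := fun _ => E) κ' 0 fun _ => x) =
    ∫⁻ ω, _ ∂(Kernel.traj (X := fun _ => E) κ' 0 fun _ => x)
  simp only [Finset.prod_range_succ _ (n + 1)]
  rw [← h2]
  refine lintegral_congr fun ω => ?_
  rw [lintegral_const_mul _ (hf _)]
  rfl

lemma lintegral_chainLaw_zero (f : E → ℝ≥0∞) (hf : Measurable f) (x : E) :
    ∫⁻ ω, f (ω 0) ∂chainLaw κ x = f x := by
  set κ' : (n : ℕ) → Kernel (Π _ : Finset.Iic n, E) E :=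
    fun n => κ.comap (fun h : (Π _ : Finset.Iic n, E) => h ⟨n, by simp⟩)
      (measurable_pi_apply _) with hκ'
  have h := Kernel.traj_map_frestrictLe_apply (X := fun _ => E) (κ := κ') 0 0 (fun _ => x)
  rw [Kernel.partialTraj_self, Kernel.id_apply] at h
  have hm : Measurable fun p : (Π _ : Finset.Iic 0, E) => f (p ⟨0, by simp⟩) :=
    hf.comp (measurable_pi_apply _)
  have h2 := congrArg (fun μ => ∫⁻ p, f (p ⟨0, by simp⟩) ∂μ) h
  beta_reduce at h2
  rwa [lintegral_dirac' _ hm, lintegral_map hm (by fun_prop)] at h2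

/-- Passes from splitting at the last state to splitting at the first: the integral of the last
factor is absorbed into the factor before it (`hfold`), the induction hypothesis splits the shorter
product at its first state, and the last factor is then released again. -/
lemma lintegral_chainLaw_prod (n : ℕ) : ∀ (f : ℕ → E → ℝ≥0∞), (∀ i, Measurable (f i)) → ∀ x : E,
    ∫⁻ ω, ∏ i ∈ Finset.range (n + 2), f i (ω i) ∂chainLaw κ x =
      f 0 x * ∫⁻ y, ∫⁻ ω, ∏ i ∈ Finset.range (n + 1), f (i + 1) (ω i) ∂chainLaw κ y ∂κ x := by
  induction n with
  | zero =>
    intro f hf x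
    rw [lintegral_chainLaw_prod_succ κ 0 f hf]
    have hm : Measurable fun y => f 0 y * ∫⁻ z, f 1 z ∂κ y := (hf 0).mul (hf 1).lintegral_kernel
    simp only [zero_add, Finset.prod_range_one]
    rw [lintegral_chainLaw_zero κ _ hm]
    congr 1
    exact lintegral_congr fun y => (lintegral_chainLaw_zero κ _ (hf 1) y).symm
  | succ n ih =>
    intro f hf x
    have hfold (f : ℕ → E → ℝ≥0∞) (g : E → ℝ≥0∞) (m : ℕ) (ω : ℕ → E) :
        (∏ i ∈ Finset.range (m + 1), f i (ω i)) * g (ω m) = ∏ i ∈ Finset.range (m + 1),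
          Function.update f m (fun y => f m y * g y) i (ω i) := by
      rw [Finset.prod_range_succ, Finset.prod_range_succ, Function.update_self, mul_assoc]
      congr 1
      refine Finset.prod_congr rfl fun i hi => ?_
      rw [Function.update_of_ne (Finset.mem_range.1 hi).ne]
    rw [lintegral_chainLaw_prod_succ κ (n + 1) f hf]
    have hg : Measurable fun y => ∫⁻ z, f (n + 2) z ∂κ y := (hf _).lintegral_kernel
    simp only [fun ω => hfold f (fun y => ∫⁻ z, f (n + 2) z ∂κ y) (n + 1) ω]
    rw [ih]
    · rw [Function.update_of_ne (by omega)]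
      congr 1
      refine lintegral_congr fun y => ?_
      rw [lintegral_chainLaw_prod_succ κ n (fun i => f (i + 1)) fun i => hf _]
      simp only [fun ω => hfold (fun i => f (i + 1)) (fun y => ∫⁻ z, f (n + 2) z ∂κ y) n ω]
      refine lintegral_congr fun ω => Finset.prod_congr rfl fun i _ => ?_
      by_cases hi : i = n
      · subst hi; simp
      · rw [Function.update_of_ne (by omega), Function.update_of_ne hi]
    · intro i
      by_cases hi : i = n + 1
      · subst hi; rw [Function.update_self]; exact (hf _).mul hg
      · rw [Function.update_of_ne hi]; exact hf i

/-- The first-step decomposition of a Markov chain. -/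
theorem lintegral_chainLaw (f : (ℕ → E) → ℝ≥0∞) (hf : Measurable f) (x : E) :
    ∫⁻ ω, f ω ∂chainLaw κ x = ∫⁻ y, ∫⁻ ω, f (consSeq x ω) ∂chainLaw κ y ∂κ x := by
  have hcx : Measurable (consSeq x) := measurable_consSeq.comp measurable_prodMk_left
  have key : chainLaw κ x = (((chainLaw κ).map (consSeq x)) ∘ₖ κ) x := by
    have := Kernel.IsMarkovKernel.map (chainLaw κ) hcx
    refine measure_ext_of_lintegral_prod fun n f hf => ?_
    have hm (n : ℕ) : Measurable fun ω : ℕ → E => ∏ i ∈ Finset.range n, f i (ω i) :=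
      Finset.measurable_prod _ fun i _ => (hf i).comp (measurable_pi_apply i)
    rw [Kernel.lintegral_comp _ _ _ (hm n)]
    simp only [fun y => Kernel.map_apply (chainLaw κ) hcx y,
      fun y => lintegral_map (μ := chainLaw κ y) (hm n) hcx]
    obtain _ | _ | n := n
    · simp
    · simp [lintegral_chainLaw_zero κ _ (hf 0)]
    · rw [lintegral_chainLaw_prod κ n f hf, ← lintegral_const_mul]
      · refine lintegral_congr fun y => ?_
        rw [← lintegral_const_mul]
        · refine lintegral_congr fun ω => ?_
          rw [Finset.prod_range_succ' _ (n + 1), mul_comm]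
          rfl
        · exact Finset.measurable_prod _ fun i _ => (hf _).comp (measurable_pi_apply i)
      · exact (Finset.measurable_prod _ fun i _ =>
          (hf _).comp (measurable_pi_apply i)).lintegral_kernel
  rw [key, Kernel.lintegral_comp _ _ _ hf]
  simp only [fun y => Kernel.map_apply (chainLaw κ) hcx y,
      fun y => lintegral_map (μ := chainLaw κ y) hf hcx]

lemma chainLaw_eval (n : ℕ) {A : Set E} (hA : MeasurableSet A) : ∀ x,
    chainLaw κ x {ω | ω n ∈ A} = (κ ^ n) x A := by
  have hm (n : ℕ) : MeasurableSet {ω : ℕ → E | ω n ∈ A} := measurable_pi_apply n hA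
  have hi (n : ℕ) (x : E) : chainLaw κ x {ω | ω n ∈ A} =
      ∫⁻ ω, A.indicator 1 (ω n) ∂chainLaw κ x := by
    rw [← lintegral_indicator_one (hm n)]; rfl
  induction n with
  | zero =>
    intro x
    rw [hi, lintegral_chainLaw_zero κ _ (measurable_one.indicator hA), pow_zero]
    exact (Measure.dirac_apply' x hA).symm
  | succ n ih =>
    intro x
    rw [hi, lintegral_chainLaw κ (fun ω => A.indicator 1 (ω (n + 1)))
      ((measurable_one.indicator hA).comp (measurable_pi_apply (n + 1))),
      add_comm, Kernel.pow_add_apply_eq_lintegral κ 1 n x hA, pow_one]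
    refine lintegral_congr fun y => ?_
    simp only [← ih, hi, add_comm 1 n, consSeq_succ]

/-- The first term of an i.i.d. sequence, split off. -/
theorem lintegral_infinitePi (μ : Measure E) [IsProbabilityMeasure μ] (f : (ℕ → E) → ℝ≥0∞)
    (hf : Measurable f) :
    ∫⁻ ω, f ω ∂Measure.infinitePi (fun _ : ℕ => μ) =
      ∫⁻ e, ∫⁻ ω, f (consSeq e ω) ∂Measure.infinitePi (fun _ : ℕ => μ) ∂μ := by
  classical
  -- It suffices to compare boxes; the preimage of a box under prepending is the product of its side
  -- at `0` and the box of its shifted sides.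
  have key : (μ.prod (Measure.infinitePi fun _ : ℕ => μ)).map (fun p => consSeq p.1 p.2) =
      Measure.infinitePi fun _ : ℕ => μ := by
    refine Measure.eq_infinitePi _ fun s t ht => ?_
    have hpre : (fun p : E × (ℕ → E) => consSeq p.1 p.2) ⁻¹' ((s : Set ℕ).pi t) =
        (if 0 ∈ s then t 0 else univ) ×ˢ
          (((s.preimage Nat.succ Nat.succ_injective.injOn : Finset ℕ) : Set ℕ).pi
            fun i => t (i + 1)) := by
      ext p
      simp only [mem_preimage, Set.mem_pi, mem_prod, Finset.mem_coe, Finset.mem_preimage]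
      constructor
      · intro h
        refine ⟨?_, fun i hi => h (i + 1) hi⟩
        split_ifs with h0
        · exact h 0 h0
        · trivial
      · rintro ⟨h0, h1⟩ i hi
        cases i with
        | zero => simpa [hi] using h0
        | succ i => exact h1 i hi
    rw [Measure.map_apply measurable_consSeq (MeasurableSet.pi s.countable_toSet fun i _ => ht i),
      hpre, Measure.prod_prod, Measure.infinitePi_pi _ fun i _ => ht _]
    have hs : ∏ i ∈ s.preimage Nat.succ Nat.succ_injective.injOn, μ (t (i + 1)) =
        ∏ i ∈ s.erase 0, μ (t i) := by
      refine Finset.prod_bij (fun i _ => i + 1) ?_ ?_ ?_ ?_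
      · intro i hi; simpa using hi
      · intro i _ j _ h; simpa using h
      · intro i hi
        obtain ⟨h0, hi⟩ := Finset.mem_erase.1 hi
        obtain ⟨j, rfl⟩ := Nat.exists_eq_succ_of_ne_zero h0
        exact ⟨j, by simpa using hi, rfl⟩
      · intros; rfl
    rw [hs]
    split_ifs with h0
    · rw [Finset.mul_prod_erase s (fun i => μ (t i)) h0]
    · rw [Finset.erase_eq_of_notMem h0, measure_univ, one_mul]
  conv_lhs => rw [← key]
  rw [lintegral_map hf measurable_consSeq]
  exact lintegral_prod _ (hf.comp measurable_consSeq).aemeasurable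

lemma lintegral_infinitePi_prod (μ : Measure E) [IsProbabilityMeasure μ] (n : ℕ) :
    ∀ f : ℕ → E → ℝ≥0∞, (∀ i, Measurable (f i)) →
    ∫⁻ ω, ∏ i ∈ Finset.range n, f i (ω i) ∂Measure.infinitePi (fun _ : ℕ => μ) =
      ∏ i ∈ Finset.range n, ∫⁻ e, f i e ∂μ := by
  have hm (n : ℕ) (f : ℕ → E → ℝ≥0∞) (hf : ∀ i, Measurable (f i)) :
      Measurable fun ω : ℕ → E => ∏ i ∈ Finset.range n, f i (ω i) :=
    Finset.measurable_prod _ fun i _ => (hf i).comp (measurable_pi_apply i)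
  induction n with
  | zero => simp
  | succ n ih =>
    intro f hf
    rw [lintegral_infinitePi _ _ (hm _ f hf)]
    simp only [Finset.prod_range_succ', consSeq_succ, consSeq_zero]
    simp only [fun e => lintegral_mul_const (μ := Measure.infinitePi fun _ : ℕ => μ) (f 0 e)
      (hm n (fun i => f (i + 1)) fun i => hf _), ih (fun i => f (i + 1)) fun i => hf _]
    rw [lintegral_const_mul _ (hf 0)]

end Sequences

/-! ### First-jump decomposition of the path law. -/

section Path

variable {E : Type*}

/-- The path that stays in `x` during the clock `e` and then follows `ω`. -/
def consPath (x : E) (e : ℝ) (ω : JumpPath E) : JumpPath E := (consSeq x ω.1, consSeq e ω.2)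

variable [MeasurableSpace E]

lemma measurable_consPath : Measurable fun p : E × ℝ × JumpPath E => consPath p.1 p.2.1 p.2.2 :=
  (measurable_consSeq.comp (by fun_prop : Measurable fun p : E × ℝ × JumpPath E =>
    (p.1, p.2.2.1))).prodMk
  (measurable_consSeq.comp (by fun_prop : Measurable fun p : E × ℝ × JumpPath E =>
    (p.2.1, p.2.2.2)))

lemma measurable_consPath_right (x : E) : Measurable fun p : ℝ × JumpPath E =>
    consPath x p.1 p.2 :=
  measurable_consPath.comp measurable_prodMk_left

variable (q : Kernel E E) [IsPosFiniteRate q]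

instance : IsMarkovKernel (pathLaw q) := by unfold pathLaw; infer_instance

/-- The first-jump decomposition of a jump process. -/
theorem lintegral_pathLaw (f : JumpPath E → ℝ≥0∞) (hf : Measurable f) (x : E) :
    ∫⁻ ω, f ω ∂pathLaw q x =
      ∫⁻ e, ∫⁻ y, ∫⁻ ω, f (consPath x e ω) ∂pathLaw q y ∂jumpKernel q x ∂expMeasure 1 := by
  have hm : Measurable fun p : (ℝ × E) × JumpPath E => f (consPath x p.1.1 p.2) :=
    hf.comp ((measurable_consPath_right x).comp (by fun_prop :
      Measurable fun p : (ℝ × E) × JumpPath E => (p.1.1, p.2)))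
  have h1 (y : E) : pathLaw q y =
      (chainLaw (jumpKernel q) y).prod (Measure.infinitePi fun _ : ℕ => expMeasure 1) := by
    rw [pathLaw, Kernel.prod_apply, Kernel.const_apply]
  have hswap : ∫⁻ e, ∫⁻ y, ∫⁻ ω, f (consPath x e ω) ∂pathLaw q y ∂jumpKernel q x ∂expMeasure 1 =
      ∫⁻ y, ∫⁻ e, ∫⁻ ω, f (consPath x e ω) ∂pathLaw q y ∂expMeasure 1 ∂jumpKernel q x := by
    refine lintegral_lintegral_swap (Measurable.aemeasurable ?_)
    exact hm.lintegral_kernel_prod_right' (κ := (pathLaw q).comap (Prod.snd : ℝ × E → E)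
      measurable_snd)
  rw [hswap, h1, lintegral_prod _ hf.aemeasurable, lintegral_chainLaw _ _
    hf.lintegral_prod_right']
  refine lintegral_congr fun y => ?_
  have hfx : Measurable fun p : ℝ × JumpPath E => f (consPath x p.1 p.2) :=
    hf.comp (measurable_consPath_right x)
  conv_rhs => rw [lintegral_lintegral_swap (hfx.aemeasurable), h1,
    lintegral_prod _ (hfx.lintegral_prod_left').aemeasurable]
  refine lintegral_congr fun ω => ?_
  have hmω : Measurable fun e : ℕ → ℝ => f (consSeq x ω, e) := hf.comp measurable_prodMk_left
  rw [lintegral_infinitePi _ _ hmω, lintegral_lintegral_swap]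
  · rfl
  · exact (hmω.comp measurable_consSeq).aemeasurable

end Path

/-! ### Exponential clocks: Laplace transform, memorylessness, divergence of weighted sums. -/

section Exponential

lemma lintegral_expMeasure (f : ℝ → ℝ≥0∞) (hf : Measurable f) :
    ∫⁻ e, f e ∂expMeasure 1 = ∫⁻ e, exponentialPDF 1 e * f e :=
  lintegral_withDensity_eq_lintegral_mul _
    (measurable_exponentialPDFReal 1).ennreal_ofReal hf

/-- Tilting the unit exponential density by `exp (-c e)` gives a multiple of the exponential density
of rate `1 + c`, which has total mass one. -/
lemma lintegral_exp_neg_mul_expMeasure {c : ℝ} (hc : 0 ≤ c) :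
    ∫⁻ e, ENNReal.ofReal (Real.exp (-(c * e))) ∂expMeasure 1 = ENNReal.ofReal (1 / (1 + c)) := by
  rw [lintegral_expMeasure _ (by fun_prop)]
  have h (e : ℝ) : exponentialPDF 1 e * ENNReal.ofReal (Real.exp (-(c * e))) =
      ENNReal.ofReal (1 / (1 + c)) * exponentialPDF (1 + c) e := by
    rw [exponentialPDF_eq, exponentialPDF_eq, ← ENNReal.ofReal_mul' (Real.exp_pos _).le,
      ← ENNReal.ofReal_mul (by positivity)]
    congr 1
    split_ifs
    · rw [one_mul, ← Real.exp_add]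
      field_simp
      ring_nf
    · simp
  simp only [h]
  rw [lintegral_const_mul' _ _ ENNReal.ofReal_ne_top,
    lintegral_exponentialPDF_eq_one (by positivity), mul_one]

lemma lintegral_indicator_sub_expMeasure {c : ℝ} (hc : 0 ≤ c) (f : ℝ → ℝ≥0∞)
    (hf : Measurable f) :
    ∫⁻ e, (Ioi c).indicator (fun e => f (e - c)) e ∂expMeasure 1 =
      ENNReal.ofReal (Real.exp (-c)) * ∫⁻ e, f e ∂expMeasure 1 := by
  have hg : Measurable ((Ioi c).indicator fun e => f (e - c)) :=
    (hf.comp (measurable_id.sub_const c)).indicator measurableSet_Ioi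
  rw [lintegral_expMeasure _ hg, lintegral_expMeasure _ hf,
    ← lintegral_const_mul' _ _ ENNReal.ofReal_ne_top,
    ← lintegral_add_right_eq_self (fun e => exponentialPDF 1 e *
      (Ioi c).indicator (fun e => f (e - c)) e) c]
  refine lintegral_congr_ae ?_
  -- After the shift by `c` the indicator of the open half-line vanishes at `0` while the density
  -- there is `1`, so this point has to be discarded.
  filter_upwards [Measure.ae_ne volume (0 : ℝ)] with e he
  rw [← mul_assoc]
  rcases lt_or_gt_of_ne he with h | h
  · rw [indicator_of_notMem (by simp [h.le]), exponentialPDF_of_neg h]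
    simp
  · rw [indicator_of_mem (by simp [h]), exponentialPDF_of_nonneg h.le,
      exponentialPDF_of_nonneg (by positivity), ← ENNReal.ofReal_mul (Real.exp_pos _).le,
      add_sub_cancel_right, one_mul, one_mul, one_mul, one_mul, neg_add, add_comm, Real.exp_add]

lemma expMeasure_Ioi {c : ℝ} (hc : 0 ≤ c) :
    expMeasure 1 (Ioi c) = ENNReal.ofReal (Real.exp (-c)) := by
  have h := lintegral_indicator_sub_expMeasure hc (fun _ => 1) measurable_const
  rw [lintegral_indicator measurableSet_Ioi] at h
  simpa using h

/-- The exponential distribution has no memory. -/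
theorem lintegral_memoryless {c : ℝ} (hc : 0 ≤ c) (f : ℝ → ℝ≥0∞) (hf : Measurable f) :
    ∫⁻ e, (Ioi c).indicator (fun e => f (e - c)) e ∂expMeasure 1 =
      expMeasure 1 (Ioi c) * ∫⁻ e, f e ∂expMeasure 1 := by
  rw [lintegral_indicator_sub_expMeasure hc f hf, expMeasure_Ioi hc]

lemma ae_expMeasure_pos : ∀ᵐ e ∂expMeasure 1, 0 < e := by
  have h : expMeasure 1 (Ioi 0) = 1 := by simp [expMeasure_Ioi le_rfl]
  exact (mem_ae_iff_prob_eq_one measurableSet_Ioi).2 h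

lemma ae_clocks_pos :
    ∀ᵐ e ∂Measure.infinitePi (fun _ : ℕ => expMeasure 1), ∀ k : ℕ, 0 < e k :=
  ae_all_iff.2 fun k => (measurePreserving_eval_infinitePi
    (fun _ : ℕ => expMeasure 1) k).quasiMeasurePreserving.ae ae_expMeasure_pos

/-- The expectation of `exp (-∑ e k / (k + 1))` over `k < n` is `∏ (k + 1) / (k + 2) = 1 / (n + 1)`.
It tends to `0`, so the infimum of these exponentials vanishes almost surely, and the increasing
partial sums are unbounded. -/
lemma ae_tendsto_sum_clocks :
    ∀ᵐ e ∂Measure.infinitePi (fun _ : ℕ => expMeasure 1),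
      Tendsto (fun n : ℕ => ∑ k ∈ Finset.range n, e k / (k + 1 : ℝ)) atTop atTop := by
  set P := Measure.infinitePi fun _ : ℕ => expMeasure 1
  let g (n : ℕ) (e : ℕ → ℝ) : ℝ≥0∞ :=
    ∏ k ∈ Finset.range n, ENNReal.ofReal (Real.exp (-((k + 1 : ℝ)⁻¹ * e k)))
  have hg (n : ℕ) : Measurable (g n) := Finset.measurable_prod _ fun k _ => by fun_prop
  have hint (n : ℕ) : ∫⁻ e, g n e ∂P = ENNReal.ofReal (1 / (n + 1)) := by
    rw [lintegral_infinitePi_prod (expMeasure 1) n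
      (fun k x => ENNReal.ofReal (Real.exp (-((k + 1 : ℝ)⁻¹ * x)))) fun k => by fun_prop]
    simp only [fun k : ℕ => lintegral_exp_neg_mul_expMeasure (c := (k + 1 : ℝ)⁻¹) (by positivity)]
    induction n with
    | zero => simp
    | succ n ih =>
      rw [Finset.prod_range_succ, ih, ← ENNReal.ofReal_mul (by positivity)]
      congr 1
      push_cast
      field_simp
  have hinf : ∫⁻ e, ⨅ n, g n e ∂P = 0 := by
    have hle (n : ℕ) : ∫⁻ e, ⨅ n, g n e ∂P ≤ ENNReal.ofReal (1 / (n + 1)) :=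
      (lintegral_mono fun e => iInf_le _ n).trans (hint n).le
    have hlim : Tendsto (fun n : ℕ => ENNReal.ofReal (1 / (n + 1))) atTop (𝓝 0) := by
      simpa using ENNReal.tendsto_ofReal tendsto_one_div_add_atTop_nhds_zero_nat
    exact le_antisymm (ge_of_tendsto' hlim hle) zero_le
  rw [lintegral_eq_zero_iff (Measurable.iInf hg)] at hinf
  filter_upwards [hinf, ae_clocks_pos] with e he hpos
  have hmono : Monotone fun n : ℕ => ∑ k ∈ Finset.range n, e k / (k + 1 : ℝ) :=
    monotone_nat_of_le_succ fun n => by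
      rw [Finset.sum_range_succ]
      have := hpos n
      have : 0 < e n / (n + 1) := by positivity
      linarith
  refine tendsto_atTop_atTop_of_monotone hmono fun b => ?_
  have hlt : (⨅ n, g n e) < ENNReal.ofReal (Real.exp (-b)) := by
    rw [he]; simpa using Real.exp_pos _
  obtain ⟨n, hn⟩ := iInf_lt_iff.1 hlt
  refine ⟨n, ?_⟩
  simp only [g] at hn
  rw [← ENNReal.ofReal_prod_of_nonneg fun _ _ => (Real.exp_pos _).le, ← Real.exp_sum,
    ENNReal.ofReal_lt_ofReal_iff (Real.exp_pos _), Real.exp_lt_exp, Finset.sum_neg_distrib,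
    neg_lt_neg_iff] at hn
  refine hn.le.trans (le_of_eq (Finset.sum_congr rfl fun k _ => ?_))
  rw [div_eq_inv_mul]

end Exponential

/-! ### Non-explosion under linear growth of the rates. -/

section NonExplosion

variable {E : Type*} [MeasurableSpace E] (q : Kernel E E) [IsPosFiniteRate q]

lemma toReal_rate_pos (x : E) : 0 < (q x univ).toReal :=
  ENNReal.toReal_pos (IsPosFiniteRate.pos x) (IsPosFiniteRate.finite x)

lemma pathLaw_apply (x : E) : pathLaw q x =
    (chainLaw (jumpKernel q) x).prod (Measure.infinitePi fun _ : ℕ => expMeasure 1) := by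
  rw [pathLaw, Kernel.prod_apply, Kernel.const_apply]

lemma ae_pathLaw_clocks {p : (ℕ → ℝ) → Prop}
    (hp : ∀ᵐ e ∂Measure.infinitePi (fun _ : ℕ => expMeasure 1), p e) (x : E) :
    ∀ᵐ ω ∂pathLaw q x, p ω.2 := by
  rw [pathLaw_apply]
  exact Measure.quasiMeasurePreserving_snd.ae hp

lemma ae_pathLaw_states {p : (ℕ → E) → Prop} {x : E}
    (hp : ∀ᵐ ω ∂chainLaw (jumpKernel q) x, p ω) :
    ∀ᵐ ω ∂pathLaw q x, p ω.1 := by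
  rw [pathLaw_apply]
  exact Measure.quasiMeasurePreserving_fst.ae hp

/-- The jump times of the path are strictly increasing and tend to infinity. -/
def IsRegularPath (ω : JumpPath E) : Prop :=
  StrictMono (jumpTime q ω) ∧ Tendsto (jumpTime q ω) atTop atTop

/-- A jump process does not explode when its rate along the jump chain grows at most linearly. -/
theorem ae_isRegularPath (x : E) (C : ℝ)
    (hC : ∀ᵐ ω ∂chainLaw (jumpKernel q) x, ∀ k : ℕ, (q (ω k) univ).toReal ≤ C * (k + 1)) :
    ∀ᵐ ω ∂pathLaw q x, IsRegularPath q ω := by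
  filter_upwards [ae_pathLaw_states q hC, ae_pathLaw_clocks q ae_clocks_pos x,
    ae_pathLaw_clocks q ae_tendsto_sum_clocks x] with ω h1 h2 h3
  have hC0 : 0 < C := by
    have := (toReal_rate_pos q (ω.1 0)).trans_le (h1 0)
    simpa using this
  refine ⟨strictMono_nat_of_lt_succ fun n => ?_, ?_⟩
  · rw [jumpTime, jumpTime, Finset.sum_range_succ]
    have := div_pos (h2 n) (toReal_rate_pos q (ω.1 n))
    linarith
  -- Term by term, the holding times dominate `C⁻¹ * e k / (k + 1)`.
  · refine tendsto_atTop_mono (fun n => ?_) (h3.const_mul_atTop (inv_pos.2 hC0))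
    rw [jumpTime, Finset.mul_sum]
    refine Finset.sum_le_sum fun k _ => ?_
    have hq := toReal_rate_pos q (ω.1 k)
    calc C⁻¹ * (ω.2 k / (k + 1)) = ω.2 k / (C * (k + 1)) := by field_simp
      _ ≤ ω.2 k / (q (ω.1 k) univ).toReal :=
        div_le_div_of_nonneg_left (h2 k).le hq (h1 k)

end NonExplosion

/-! ### The path seen from a fixed time. -/

section Restart

lemma indicator_eq_indicator_of_mem_iff {α β M : Type*} [Zero M] {s : Set α} {t : Set β}
    {f : α → M} {g : β → M} {a : α} {b : β} (h : a ∈ s ↔ b ∈ t) (hfg : f a = g b) :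
    s.indicator f a = t.indicator g b := by
  by_cases ha : a ∈ s
  · rw [indicator_of_mem ha, indicator_of_mem (h.1 ha), hfg]
  · rw [indicator_of_notMem ha, indicator_of_notMem (mt h.2 ha)]

variable {E : Type*}

/-- The two paths have the same first `n + 1` states and the same first `n` clocks. -/
def AgreeUpTo (n : ℕ) (ω ω' : JumpPath E) : Prop :=
  (∀ k ≤ n, ω.1 k = ω'.1 k) ∧ ∀ k < n, ω.2 k = ω'.2 k

lemma AgreeUpTo.consPath {n : ℕ} {ω ω' : JumpPath E} (h : AgreeUpTo n ω ω') (x : E) (e : ℝ) :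
    AgreeUpTo (n + 1) (consPath x e ω) (consPath x e ω') := by
  constructor
  · rintro (_ | k) hk
    · rfl
    · exact h.1 k (by omega)
  · rintro (_ | k) hk
    · rfl
    · exact h.2 k (by omega)

variable [MeasurableSpace E] (q : Kernel E E)

@[simp] lemma jumpTime_zero (ω : JumpPath E) : jumpTime q ω 0 = 0 := by simp [jumpTime]

lemma jumpTime_succ (ω : JumpPath E) (n : ℕ) :
    jumpTime q ω (n + 1) = jumpTime q ω n + ω.2 n / (q (ω.1 n) univ).toReal := by
  rw [jumpTime, jumpTime, Finset.sum_range_succ]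

lemma jumpTime_consPath (x : E) (e : ℝ) (ω : JumpPath E) (n : ℕ) :
    jumpTime q (consPath x e ω) (n + 1) = e / (q x univ).toReal + jumpTime q ω n := by
  rw [jumpTime, jumpTime, Finset.sum_range_succ', add_comm]
  rfl

lemma measurable_jumpTime (n : ℕ) : Measurable fun ω : JumpPath E => jumpTime q ω n := by
  refine Finset.measurable_sum _ fun k _ => Measurable.div (by fun_prop) ?_
  exact (q.measurable_coe MeasurableSet.univ).ennreal_toReal.comp
    ((measurable_pi_apply k).comp measurable_fst)

/-- The paths that have made exactly `n` jumps by time `s`. -/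
def jumpsBy (n : ℕ) (s : ℝ) : Set (JumpPath E) :=
  {ω | jumpTime q ω n ≤ s ∧ s < jumpTime q ω (n + 1)}

lemma measurableSet_jumpsBy (n : ℕ) (s : ℝ) : MeasurableSet (jumpsBy q n s) :=
  (measurableSet_le (measurable_jumpTime q n) measurable_const).inter
    (measurableSet_lt measurable_const (measurable_jumpTime q (n + 1)))

/-- The path seen from time `s`, when `n` jumps have been made by then. -/
def restart (n : ℕ) (s : ℝ) (ω : JumpPath E) : JumpPath E :=
  (fun k => ω.1 (n + k), consSeq ((jumpTime q ω (n + 1) - s) * (q (ω.1 n) univ).toReal)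
    fun k => ω.2 (n + k + 1))

lemma measurable_restart (n : ℕ) (s : ℝ) : Measurable (restart q n s) := by
  have h1 : Measurable fun ω : JumpPath E => (q (ω.1 n) univ).toReal :=
    (q.measurable_coe MeasurableSet.univ).ennreal_toReal.comp
      ((measurable_pi_apply n).comp measurable_fst)
  refine Measurable.prodMk (by fun_prop) ?_
  exact measurable_consSeq.comp
    ((((measurable_jumpTime q (n + 1)).sub_const s).mul h1).prodMk (by fun_prop))

lemma AgreeUpTo.jumpTime_eq {n : ℕ} {ω ω' : JumpPath E} (h : AgreeUpTo n ω ω') {k : ℕ}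
    (hk : k ≤ n) : jumpTime q ω k = jumpTime q ω' k := by
  refine Finset.sum_congr rfl fun j hj => ?_
  have := Finset.mem_range.1 hj
  rw [h.1 j (by omega), h.2 j (by omega)]

variable [IsPosFiniteRate q]

/-- Given the path up to the last jump before time `s`, the path seen from time `s` is distributed
as the path started at the current state. -/
theorem lintegral_restart (n : ℕ) : ∀ (s : ℝ) (g f : JumpPath E → ℝ≥0∞), Measurable g →
    (∀ ω ω', AgreeUpTo n ω ω' → g ω = g ω') → Measurable f → ∀ x,
    ∫⁻ ω, (jumpsBy q n s).indicator (fun ω => g ω * f (restart q n s ω)) ω ∂pathLaw q x =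
      ∫⁻ ω, (jumpsBy q n s).indicator (fun ω => g ω * ∫⁻ ω', f ω' ∂pathLaw q (ω.1 n)) ω
        ∂pathLaw q x := by
  have hm1 (n : ℕ) (s : ℝ) (g f : JumpPath E → ℝ≥0∞) (hg : Measurable g) (hf : Measurable f) :
      Measurable ((jumpsBy q n s).indicator fun ω => g ω * f (restart q n s ω)) :=
    (hg.mul (hf.comp (measurable_restart q n s))).indicator (measurableSet_jumpsBy q n s)
  have hm2 (n : ℕ) (s : ℝ) (g f : JumpPath E → ℝ≥0∞) (hg : Measurable g) (hf : Measurable f) :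
      Measurable ((jumpsBy q n s).indicator fun ω => g ω * ∫⁻ ω', f ω' ∂pathLaw q (ω.1 n)) :=
    (hg.mul (hf.lintegral_kernel.comp
      ((measurable_pi_apply n).comp measurable_fst))).indicator (measurableSet_jumpsBy q n s)
  induction n with
  | zero =>
    intro s g f hg hgd hf x
    -- The inductive step replaces `s` by `s` minus a holding time, so negative `s` must be allowed;
    -- the event is then empty.
    rcases lt_or_ge s 0 with hs | hs
    · have : jumpsBy q 0 s = ∅ := by
        ext ω; simp [jumpsBy, hs.not_ge]
      simp [this]
    have hq := toReal_rate_pos q x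
    -- The time `s` measured on the unit-rate clock: the first jump comes after `s` exactly when the
    -- clock exceeds `c`.
    set c := s * (q x univ).toReal with hc
    have hc0 : 0 ≤ c := by positivity
    -- For `n = 0`, `g` sees only the initial state, so the later states and all clocks in this
    -- representative are arbitrary.
    set γ := g (fun _ => x, fun _ => 0)
    have hγ (e : ℝ) (ω : JumpPath E) : g (consPath x e ω) = γ :=
      hgd _ _ ⟨fun k hk => by obtain rfl : k = 0 := by omega
                              rfl, fun k hk => by omega⟩
    have hD (e : ℝ) (ω : JumpPath E) : consPath x e ω ∈ jumpsBy q 0 s ↔ e ∈ Ioi c := by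
      simp only [jumpsBy, mem_ofPred_eq, jumpTime_zero, hs, true_and, jumpTime_consPath, add_zero,
        mem_Ioi, hc]
      exact lt_div_iff₀ hq
    have hθ (e : ℝ) (ω : JumpPath E) :
        restart q 0 s (consPath x e ω) = consPath x (e - c) ω := by
      refine Prod.ext ?_ ?_
      · funext k; simp [restart, consPath]
      · funext k
        cases k with
        | zero =>
          simp only [restart, jumpTime_consPath, jumpTime_zero, consSeq_zero, hc]
          simp only [consPath, consSeq_zero]
          field_simp
          ring
        | succ k => simp [restart, consPath]
    rw [lintegral_pathLaw q _ (hm1 0 s g f hg hf), lintegral_pathLaw q _ (hm2 0 s g f hg hf)]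
    have hfx : Measurable fun p : ℝ × JumpPath E => f (consPath x p.1 p.2) :=
      hf.comp (measurable_consPath_right x)
    have hF : Measurable fun e : ℝ =>
        ∫⁻ y, ∫⁻ ω, f (consPath x e ω) ∂pathLaw q y ∂jumpKernel q x := by
      have : Measurable fun p : ℝ × E => ∫⁻ ω, f (consPath x p.1 ω) ∂pathLaw q p.2 :=
        Measurable.lintegral_kernel_prod_right'
          (κ := (pathLaw q).comap (Prod.snd : ℝ × E → E) measurable_snd)
          (f := fun p : (ℝ × E) × JumpPath E => f (consPath x p.1.1 p.2))
          (hfx.comp (by fun_prop : Measurable fun p : (ℝ × E) × JumpPath E => (p.1.1, p.2)))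
      exact this.lintegral_prod_right'
    have hleft (e : ℝ) : ∫⁻ y, ∫⁻ ω, (jumpsBy q 0 s).indicator
        (fun ω => g ω * f (restart q 0 s ω)) (consPath x e ω) ∂pathLaw q y ∂jumpKernel q x =
        (Ioi c).indicator (fun e => (fun e => γ *
          ∫⁻ y, ∫⁻ ω, f (consPath x e ω) ∂pathLaw q y ∂jumpKernel q x) (e - c)) e := by
      by_cases he : e ∈ Ioi c
      · simp only [fun ω => indicator_of_mem ((hD e ω).2 he) (fun ω => g ω * f (restart q 0 s ω)),
          indicator_of_mem he, hγ, hθ]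
        have hme : Measurable fun ω => f (consPath x (e - c) ω) := hfx.comp measurable_prodMk_left
        simp only [fun y => lintegral_const_mul (μ := pathLaw q y) γ hme]
        rw [lintegral_const_mul _ hme.lintegral_kernel]
      · simp only [fun ω => indicator_of_notMem (mt (hD e ω).1 he)
          (fun ω => g ω * f (restart q 0 s ω)), indicator_of_notMem he, lintegral_zero]
    have hright (e : ℝ) : ∫⁻ y, ∫⁻ ω, (jumpsBy q 0 s).indicator
        (fun ω => g ω * ∫⁻ ω', f ω' ∂pathLaw q (ω.1 0)) (consPath x e ω) ∂pathLaw q y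
          ∂jumpKernel q x =
        (Ioi c).indicator (fun _ => γ * ∫⁻ ω', f ω' ∂pathLaw q x) e := by
      by_cases he : e ∈ Ioi c
      · simp only [fun ω => indicator_of_mem ((hD e ω).2 he)
          (fun ω => g ω * ∫⁻ ω', f ω' ∂pathLaw q (ω.1 0)), indicator_of_mem he, hγ]
        simp [consPath]
      · simp only [fun ω => indicator_of_notMem (mt (hD e ω).1 he)
          (fun ω => g ω * ∫⁻ ω', f ω' ∂pathLaw q (ω.1 0)), indicator_of_notMem he, lintegral_zero]
    simp only [hleft, hright]
    -- Memorylessness removes the shift by `c`; the first-jump decomposition read backwards then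
    -- reassembles the law of a path from `x`.
    rw [lintegral_memoryless hc0 _ (hF.const_mul γ), lintegral_const_mul _ hF,
      ← lintegral_pathLaw q f hf, lintegral_indicator measurableSet_Ioi, setLIntegral_const,
      mul_comm]
  | succ n ih =>
    intro s g f hg hgd hf x
    rw [lintegral_pathLaw q _ (hm1 (n + 1) s g f hg hf),
      lintegral_pathLaw q _ (hm2 (n + 1) s g f hg hf)]
    refine lintegral_congr fun e => lintegral_congr fun y => ?_
    have hD (ω : JumpPath E) : consPath x e ω ∈ jumpsBy q (n + 1) s ↔
        ω ∈ jumpsBy q n (s - e / (q x univ).toReal) := by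
      simp only [jumpsBy, mem_ofPred_eq, jumpTime_consPath]
      rw [le_sub_iff_add_le', sub_lt_iff_lt_add']
    have hθ (ω : JumpPath E) : restart q (n + 1) s (consPath x e ω) =
        restart q n (s - e / (q x univ).toReal) ω := by
      refine Prod.ext ?_ ?_
      · funext k
        simp [restart, consPath, add_right_comm n 1 k]
      · funext k
        cases k with
        | zero =>
          simp only [restart, jumpTime_consPath, consSeq_zero]
          simp only [consPath, consSeq_succ]
          ring
        | succ k => simp [restart, consPath, add_right_comm n 1 k]
    -- With the first state and clock fixed, `n + 1` jumps by `s` amount to `n` jumps of the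
    -- remaining path by the reduced time.
    have key := ih (s - e / (q x univ).toReal) (fun ω => g (consPath x e ω)) f
      (hg.comp ((measurable_consPath_right x).comp measurable_prodMk_left))
      (fun ω ω' h => hgd _ _ (h.consPath x e)) hf y
    convert key using 2
    · funext ω
      exact indicator_eq_indicator_of_mem_iff (hD ω) (by rw [hθ])
    · funext ω
      exact indicator_eq_indicator_of_mem_iff (hD ω) rfl

end Restart

/-! ### Measurability, path structure, and the past on the event of `n` jumps. -/

section PathRegularity

variable {E : Type*} [MeasurableSpace E] (q : Kernel E E)

lemma measurable_sInf_nat {Ω : Type*} [MeasurableSpace Ω] (P : ℕ → Set Ω)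
    (hP : ∀ k, MeasurableSet (P k)) : Measurable fun ω => sInf {k | ω ∈ P k} := by
  refine measurable_to_countable' fun n => ?_
  -- The second piece accounts for the convention `sInf ∅ = 0`.
  have h : (fun ω => sInf {k | ω ∈ P k}) ⁻¹' {n} =
      (P n ∩ ⋂ k, ⋂ _ : k < n, (P k)ᶜ) ∪ ({_ω | n = 0} ∩ ⋂ k, (P k)ᶜ) := by
    ext ω
    simp only [mem_preimage, mem_singleton_iff, mem_union, mem_inter_iff, mem_iInter, mem_compl_iff,
      mem_ofPred_eq]
    constructor
    · rintro rfl
      by_cases hne : {k | ω ∈ P k}.Nonempty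
      · exact Or.inl ⟨Nat.sInf_mem hne, fun k hk => Nat.notMem_of_lt_sInf hk⟩
      · rw [not_nonempty_iff_eq_empty] at hne
        exact Or.inr ⟨by rw [hne, Nat.sInf_empty], fun k hk => (hne ▸ hk : k ∈ (∅ : Set ℕ))⟩
    · rintro (⟨h1, h2⟩ | ⟨h1, h2⟩)
      · refine le_antisymm (Nat.sInf_le h1) (le_csInf ⟨n, h1⟩ fun k hk => ?_)
        by_contra hkn
        exact h2 k (not_le.1 hkn) hk
      · rw [h1, Nat.sInf_eq_zero]
        exact Or.inr (eq_empty_of_forall_notMem h2)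
  rw [h]
  exact ((hP n).inter (MeasurableSet.iInter fun k => MeasurableSet.iInter fun _ =>
    (hP k).compl)).union ((MeasurableSet.const _).inter
      (MeasurableSet.iInter fun k => (hP k).compl))

lemma measurable_state_comp {N : JumpPath E → ℕ} (hN : Measurable N) :
    Measurable fun ω : JumpPath E => ω.1 (N ω) := by
  have h : Measurable fun p : JumpPath E × ℕ => p.1.1 p.2 :=
    measurable_from_prod_countable_left fun n =>
      (measurable_pi_apply n).comp measurable_fst
  exact h.comp (measurable_id.prodMk hN)

lemma measurable_jumpProcess (t : ℝ≥0) : Measurable (jumpProcess q t) :=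
  measurable_state_comp (measurable_sInf_nat (fun n => {ω | (t : ℝ) < jumpTime q ω (n + 1)})
    fun n => measurableSet_lt measurable_const (measurable_jumpTime q (n + 1)))

variable {q} {ω : JumpPath E}

lemma le_sInf_of_jumpTime_le (h : IsRegularPath q ω) {n : ℕ} {s t : ℝ} (hn : jumpTime q ω n ≤ s)
    (hst : s ≤ t) : n ≤ sInf {k | t < jumpTime q ω (k + 1)} := by
  refine le_csInf ?_ fun k hk => ?_
  · obtain ⟨k, hk⟩ := (h.2.eventually_gt_atTop t).exists
    exact ⟨k, hk.trans (h.1 k.lt_succ_self)⟩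
  · by_contra hkn
    have := h.1.monotone (show k + 1 ≤ n by omega)
    have hk' : t < jumpTime q ω (k + 1) := hk
    linarith

lemma jumpProcess_eq (h : IsRegularPath q ω) {n : ℕ} {s : ℝ≥0} (hD : ω ∈ jumpsBy q n s) :
    jumpProcess q s ω = ω.1 n := by
  have : sInf {k | (s : ℝ) < jumpTime q ω (k + 1)} = n :=
    le_antisymm (Nat.sInf_le hD.2) (le_sInf_of_jumpTime_le h hD.1 le_rfl)
  rw [jumpProcess, this]

lemma exists_mem_jumpsBy (h : IsRegularPath q ω) (s : ℝ≥0) : ∃ n, ω ∈ jumpsBy q n s := by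
  classical
  have hex : ∃ k, (s : ℝ) < jumpTime q ω k := (h.2.eventually_gt_atTop (s : ℝ)).exists
  obtain ⟨n, hn⟩ : ∃ n, Nat.find hex = n + 1 := Nat.exists_eq_succ_of_ne_zero fun h0 => by
    have := Nat.find_spec hex
    rw [h0, jumpTime_zero] at this
    exact absurd s.2 (not_le.2 this)
  exact ⟨n, not_lt.1 (Nat.find_min hex (by omega)), hn ▸ Nat.find_spec hex⟩

lemma jumpsBy_unique (h : IsRegularPath q ω) {n m : ℕ} {s : ℝ} (hn : ω ∈ jumpsBy q n s)
    (hm : ω ∈ jumpsBy q m s) : n = m := by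
  have h1 := h.1.lt_iff_lt.1 (hn.1.trans_lt hm.2)
  have h2 := h.1.lt_iff_lt.1 (hm.1.trans_lt hn.2)
  omega

/-- The residual holding time was multiplied by the rate in `restart`, and `jumpTime` divides it
again. The index starts at `k + 1` because the zeroth jump time of the restarted path is `0`, not
the `n`-th jump time minus `s`. -/
lemma jumpTime_restart [IsPosFiniteRate q] (n k : ℕ) (s : ℝ) :
    jumpTime q (restart q n s ω) (k + 1) = jumpTime q ω (n + k + 1) - s := by
  induction k with
  | zero =>
    have := (toReal_rate_pos q (ω.1 n)).ne'
    rw [jumpTime_succ, jumpTime_zero, zero_add]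
    simp [restart, this]
  | succ k ih =>
    rw [jumpTime_succ, ih, ← add_assoc, jumpTime_succ q ω (n + k + 1)]
    simp only [restart, consSeq_succ, ← add_assoc]
    ring

/-- By time `s + t` at least `n` jumps have occurred, so the first `n` indices can be skipped when
searching for the current state. -/
lemma jumpProcess_restart [IsPosFiniteRate q] (h : IsRegularPath q ω) {n : ℕ} {s : ℝ≥0}
    (hD : ω ∈ jumpsBy q n s) (t : ℝ≥0) :
    jumpProcess q t (restart q n s ω) = jumpProcess q (s + t) ω := by
  have hle := le_sInf_of_jumpTime_le h hD.1 (t := ((s + t : ℝ≥0) : ℝ)) (by simp)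
  have hset : {k | (t : ℝ) < jumpTime q (restart q n s ω) (k + 1)} =
      {k | ((s + t : ℝ≥0) : ℝ) < jumpTime q ω (k + n + 1)} := by
    ext k
    simp only [mem_ofPred_eq, jumpTime_restart, NNReal.coe_add, add_comm n k]
    exact lt_sub_iff_add_lt'
  rw [jumpProcess, jumpProcess, hset]
  change ω.1 (n + _) = _
  rw [add_comm n, Nat.sInf_add (p := fun k => ((s + t : ℝ≥0) : ℝ) < jumpTime q ω (k + 1)) hle]

variable (q) in
/-- The sets that, on the event of `n` jumps by time `s`, are determined by the first `n + 1`
states and the first `n` clocks. -/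
@[reducible]
def historySpace (n : ℕ) (s : ℝ) : MeasurableSpace (JumpPath E) where
  MeasurableSet' := fun F => ∃ G : Set (JumpPath E), MeasurableSet G ∧
    (∀ ω ω', AgreeUpTo n ω ω' → (ω ∈ G ↔ ω' ∈ G)) ∧ ∀ ω ∈ jumpsBy q n s, (ω ∈ F ↔ ω ∈ G)
  measurableSet_empty := ⟨∅, MeasurableSet.empty, by simp, by simp⟩
  measurableSet_compl := by
    rintro F ⟨G, hG, h1, h2⟩
    exact ⟨Gᶜ, hG.compl, fun ω ω' h => not_congr (h1 ω ω' h), fun ω h => not_congr (h2 ω h)⟩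
  measurableSet_iUnion := by
    intro F hF
    choose G hG h1 h2 using hF
    refine ⟨⋃ i, G i, MeasurableSet.iUnion hG, fun ω ω' h => ?_, fun ω h => ?_⟩
    · simp only [mem_iUnion, fun i => h1 i ω ω' h]
    · simp only [mem_iUnion, fun i => h2 i ω h]

/-- On the event of `n` jumps by time `s`, the past of time `s` is a function of the first `n + 1`
states and the first `n` clocks. -/
lemma exists_agreeUpTo_of_past (s : ℝ≥0) (n : ℕ) {F : Set (JumpPath E)}
    (hF : MeasurableSet[⨆ u ∈ Iic s, MeasurableSpace.comap (jumpProcess q u) inferInstance] F) :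
    ∃ G : Set (JumpPath E), MeasurableSet G ∧ (∀ ω ω', AgreeUpTo n ω ω' → (ω ∈ G ↔ ω' ∈ G)) ∧
      ∀ ω ∈ jumpsBy q n s, (ω ∈ F ↔ ω ∈ G) := by
  -- Since `historySpace` is a σ-field, it is enough to treat the state at one time `u ≤ s`.
  have hle : (⨆ u ∈ Iic s, MeasurableSpace.comap (jumpProcess q u) inferInstance) ≤
      historySpace q n s := by
    refine iSup₂_le fun u hu => ?_
    rintro _ ⟨A, hA, rfl⟩
    -- Truncating the search at `n` makes it depend only on the jump times up to the `n`-th. On the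
    -- event of `n` jumps by `s` the truncation changes nothing, since `u ≤ s` precedes the next
    -- jump.
    let S (ω : JumpPath E) : Set ℕ := {k | n ≤ k ∨ (u : ℝ) < jumpTime q ω (k + 1)}
    have hS (ω : JumpPath E) : sInf (S ω) ≤ n := Nat.sInf_le (Or.inl le_rfl)
    have hN : Measurable fun ω => sInf (S ω) :=
      measurable_sInf_nat (fun k => {ω | n ≤ k ∨ (u : ℝ) < jumpTime q ω (k + 1)})
        fun k => (MeasurableSet.const _).union
          (measurableSet_lt measurable_const (measurable_jumpTime q (k + 1)))
    refine ⟨{ω | ω.1 (sInf (S ω)) ∈ A}, measurable_state_comp hN hA, fun ω ω' h => ?_,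
      fun ω hω => ?_⟩
    · have : S ω = S ω' := by
        ext k
        by_cases hk : n ≤ k
        · simp [S, hk]
        · simp only [S, mem_ofPred_eq, h.jumpTime_eq q (show k + 1 ≤ n by omega)]
      simp only [mem_ofPred_eq, this, h.1 _ (hS ω')]
    · have hn : n ∈ {k | (u : ℝ) < jumpTime q ω (k + 1)} :=
        (NNReal.coe_le_coe.2 hu).trans_lt hω.2
      have : sInf {k | (u : ℝ) < jumpTime q ω (k + 1)} = sInf (S ω) := by
        refine le_antisymm ?_ (Nat.sInf_le (Or.inr (Nat.sInf_mem ⟨n, hn⟩)))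
        rcases Nat.sInf_mem (s := S ω) ⟨n, Or.inl le_rfl⟩ with h | h
        · exact (Nat.sInf_le hn).trans h
        · exact Nat.sInf_le h
      simp only [mem_preimage, jumpProcess, this, mem_ofPred_eq]
  exact hle F hF

end PathRegularity

/-! ### The Markov property. -/

section MarkovProperty

variable {E : Type*} [MeasurableSpace E] (q : Kernel E E)

lemma past_le (s : ℝ≥0) :
    (⨆ u ∈ Iic s, MeasurableSpace.comap (jumpProcess q u) inferInstance) ≤
      (inferInstance : MeasurableSpace (JumpPath E)) :=
  iSup₂_le fun u _ => (measurable_jumpProcess q u).comap_le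

variable [IsPosFiniteRate q]

lemma lintegral_eq_tsum_jumpsBy {x : E} (hreg : ∀ᵐ ω ∂pathLaw q x, IsRegularPath q ω) (s : ℝ≥0)
    (f : JumpPath E → ℝ≥0∞) (hf : Measurable f) :
    ∫⁻ ω, f ω ∂pathLaw q x = ∑' n, ∫⁻ ω, (jumpsBy q n s).indicator f ω ∂pathLaw q x := by
  rw [← lintegral_tsum fun n => (hf.indicator (measurableSet_jumpsBy q n s)).aemeasurable]
  refine lintegral_congr_ae ?_
  filter_upwards [hreg] with ω hω
  obtain ⟨n, hn⟩ := exists_mem_jumpsBy hω s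
  rw [tsum_eq_single n fun m hm => indicator_of_notMem
    (fun h => hm (jumpsBy_unique hω h hn)) _, indicator_of_mem hn]

/-- The Markov property tested against a past event `F`. On each event of `n` jumps by `s`, `F` may
be replaced by a set `G` fixed by the first states and clocks, so `lintegral_restart` applies with
the indicator of `G`; the restarted path at `t` is the original one at `s + t`. -/
lemma measure_past_inter {x : E} (hreg : ∀ᵐ ω ∂pathLaw q x, IsRegularPath q ω) (s t : ℝ≥0)
    {A : Set E} (hA : MeasurableSet A) {F : Set (JumpPath E)}
    (hF : MeasurableSet[⨆ u ∈ Iic s, MeasurableSpace.comap (jumpProcess q u) inferInstance] F) :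
    ∫⁻ ω in F, pathLaw q (jumpProcess q s ω) (jumpProcess q t ⁻¹' A) ∂pathLaw q x =
      pathLaw q x (F ∩ jumpProcess q (s + t) ⁻¹' A) := by
  have hF' := past_le q s F hF
  have hB (t : ℝ≥0) : MeasurableSet (jumpProcess q t ⁻¹' A) := measurable_jumpProcess q t hA
  have hker : Measurable fun ω => pathLaw q (jumpProcess q s ω) (jumpProcess q t ⁻¹' A) :=
    ((pathLaw q).measurable_coe (hB t)).comp (measurable_jumpProcess q s)
  rw [← lintegral_indicator_one (hF'.inter (hB _)), ← lintegral_indicator hF',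
    lintegral_eq_tsum_jumpsBy q hreg s _ (hker.indicator hF'),
    lintegral_eq_tsum_jumpsBy q hreg s _ (measurable_one.indicator (hF'.inter (hB _)))]
  refine tsum_congr fun n => ?_
  obtain ⟨G, hG, hG1, hG2⟩ := exists_agreeUpTo_of_past s n hF
  have key := lintegral_restart q n s (G.indicator 1) ((jumpProcess q t ⁻¹' A).indicator 1)
    (measurable_one.indicator hG) (fun ω ω' h => indicator_eq_indicator_of_mem_iff (hG1 ω ω' h) rfl)
    (measurable_one.indicator (hB t)) x
  simp only [lintegral_indicator_one (hB t)] at key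
  refine (Eq.trans ?_ key.symm).trans ?_
  · refine lintegral_congr_ae ?_
    filter_upwards [hreg] with ω hω
    by_cases hD : ω ∈ jumpsBy q n s
    · rw [indicator_of_mem hD, indicator_of_mem hD, ← jumpProcess_eq hω hD]
      by_cases h : ω ∈ G
      · simp [h, (hG2 ω hD).2 h]
      · simp [h, mt (hG2 ω hD).1 h]
    · rw [indicator_of_notMem hD, indicator_of_notMem hD]
  · refine lintegral_congr_ae ?_
    filter_upwards [hreg] with ω hω
    by_cases hD : ω ∈ jumpsBy q n s
    · rw [indicator_of_mem hD, indicator_of_mem hD, inter_indicator_one, Pi.mul_apply]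
      congr 1
      · exact indicator_eq_indicator_of_mem_iff (hG2 ω hD).symm rfl
      · refine indicator_eq_indicator_of_mem_iff ?_ rfl
        rw [mem_preimage, mem_preimage, jumpProcess_restart hω hD]
    · rw [indicator_of_notMem hD, indicator_of_notMem hD]

lemma condExp_jumpProcess {x : E} (hreg : ∀ᵐ ω ∂pathLaw q x, IsRegularPath q ω) (s t : ℝ≥0)
    {A : Set E} (hA : MeasurableSet A) :
    (pathLaw q x)⟦(jumpProcess q (s + t)) ⁻¹' A |
        ⨆ u ∈ Iic s, MeasurableSpace.comap (jumpProcess q u) inferInstance⟧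
      =ᵐ[pathLaw q x] fun ω => (pathLaw q (jumpProcess q s ω)).real (jumpProcess q t ⁻¹' A) := by
  have hB (t : ℝ≥0) : MeasurableSet (jumpProcess q t ⁻¹' A) := measurable_jumpProcess q t hA
  have hk : Measurable fun y => (pathLaw q y).real (jumpProcess q t ⁻¹' A) :=
    ((pathLaw q).measurable_coe (hB t)).ennreal_toReal
  have hs : Measurable[⨆ u ∈ Iic s, MeasurableSpace.comap (jumpProcess q u) inferInstance]
      (jumpProcess q s) :=
    measurable_iff_comap_le.2 (le_iSup₂_of_le (f := fun u (_ : u ∈ Iic s) =>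
      MeasurableSpace.comap (jumpProcess q u) inferInstance) s (mem_Iic.2 le_rfl) le_rfl)
  have hint : Integrable (fun ω => (pathLaw q (jumpProcess q s ω)).real (jumpProcess q t ⁻¹' A))
      (pathLaw q x) := by
    refine Integrable.of_bound (hk.comp (measurable_jumpProcess q s)).aestronglyMeasurable 1
      (ae_of_all _ fun ω => ?_)
    rw [Real.norm_of_nonneg measureReal_nonneg]
    exact measureReal_le_one
  refine (ae_eq_condExp_of_forall_setIntegral_eq (past_le q s)
    ((integrable_const (1 : ℝ)).indicator (hB (s + t))) (fun F _ _ => hint.integrableOn)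
    (fun F hF _ => ?_) ?_).symm
  · rw [integral_indicator (hB _), setIntegral_const, smul_eq_mul, mul_one,
      measureReal_restrict_apply (hB _), inter_comm, measureReal_def,
      ← measure_past_inter q hreg s t hA hF]
    exact integral_toReal (((pathLaw q).measurable_coe (hB t)).comp
      (measurable_jumpProcess q s)).aemeasurable (ae_of_all _ fun ω => measure_lt_top _ _)
  · exact (hk.comp hs).aestronglyMeasurable

theorem isMarkovJumpProcess_of_regular [MeasurableSingletonClass E]
    (hreg : ∀ x, ∀ᵐ ω ∂pathLaw q x, IsRegularPath q ω) :
    IsMarkovJumpProcess (pathLaw q) (jumpProcess q) where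
  isMarkovKernel := inferInstance
  measurable := measurable_jumpProcess q
  start x := by
    have h0 : ∀ᵐ ω ∂chainLaw (jumpKernel q) x, ω 0 = x := by
      have h := chainLaw_eval (jumpKernel q) 0 (measurableSet_singleton x).compl x
      rw [pow_zero] at h
      refine h.trans ?_
      exact (Measure.dirac_apply' x (measurableSet_singleton x).compl).trans (by simp)
    filter_upwards [hreg x, ae_pathLaw_states q h0] with ω hω h
    rw [← h]
    refine jumpProcess_eq hω ⟨by simp, ?_⟩
    simpa using hω.1 zero_lt_one
  step x := by
    filter_upwards [hreg x] with ω hω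
    have hpos (n : ℕ) : 0 ≤ jumpTime q ω n := by
      simpa using hω.1.monotone (Nat.zero_le n)
    have hT (n : ℕ) : (((jumpTime q ω n).toNNReal : ℝ≥0) : ℝ) = jumpTime q ω n :=
      Real.coe_toNNReal _ (hpos n)
    refine ⟨fun n => (jumpTime q ω n).toNNReal, by simp,
      fun n m h => Real.toNNReal_le_toNNReal (hω.1.monotone h),
      tendsto_real_toNNReal_atTop.comp hω.2, fun n t ht => ?_⟩
    rw [jumpProcess_eq hω (n := n), jumpProcess_eq hω (n := n)]
    · exact ⟨(hT n).ge, (hT n).trans_lt (hω.1 n.lt_succ_self)⟩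
    · exact ⟨(hT n).ge.trans (NNReal.coe_le_coe.2 ht.1),
        (NNReal.coe_lt_coe.2 ht.2).trans_eq (hT (n + 1))⟩
  markov x s t A hA := condExp_jumpProcess q (hreg x) s t hA

end MarkovProperty

/-! ### From the jump chain to occupation times. -/

section Occupation

variable {E : Type*} [MeasurableSpace E] (q : Kernel E E) [IsPosFiniteRate q]

lemma pathLaw_state (n : ℕ) {A : Set E} (hA : MeasurableSet A) (x : E) :
    pathLaw q x {ω | ω.1 n ∈ A} = (jumpKernel q ^ n) x A := by
  rw [← chainLaw_eval (jumpKernel q) n hA x, pathLaw_apply]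
  have h := Measure.prod_prod (μ := chainLaw (jumpKernel q) x)
    (ν := Measure.infinitePi fun _ : ℕ => expMeasure 1) {ω | ω n ∈ A} univ
  rw [measure_univ, mul_one, prod_univ] at h
  exact h

/-- A set of states reached by the jump chain has positive expected occupation time. -/
theorem occupation_pos_of_jumpKernel_pow_pos {x : E}
    (hreg : ∀ᵐ ω ∂pathLaw q x, IsRegularPath q ω) {A : Set E} (hA : MeasurableSet A) {n : ℕ}
    (hn : 0 < (jumpKernel q ^ n) x A) :
    0 < ∫⁻ t in Ici (0 : ℝ), pathLaw q x {ω | jumpProcess q t.toNNReal ω ∈ A} := by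
  -- Tonelli is applied to `S` in both orders. For a fixed path whose `n`-th state is in `A`, the
  -- section is the interval between two successive jump times, of positive length; for a fixed time
  -- `t ≥ 0`, the section lies almost surely in the event that the process is in `A`.
  set S : Set (ℝ × JumpPath E) := {p | p.2 ∈ jumpsBy q n p.1 ∧ p.2.1 n ∈ A} with hS
  have hSm : MeasurableSet S :=
    ((measurableSet_le ((measurable_jumpTime q n).comp measurable_snd) measurable_fst).inter
      (measurableSet_lt measurable_fst ((measurable_jumpTime q (n + 1)).comp measurable_snd))).inter
      (((measurable_pi_apply n).comp (measurable_fst.comp measurable_snd)) hA)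
  have hpos : 0 < ((volume.restrict (Ici (0 : ℝ))).prod (pathLaw q x)) S := by
    rw [pos_iff_ne_zero, Measure.prod_apply_symm hSm]
    intro h0
    rw [lintegral_eq_zero_iff (measurable_measure_prodMk_right hSm)] at h0
    rw [← pathLaw_state q n hA] at hn
    refine hn.ne' (measure_eq_zero_iff_ae_notMem.2 ?_)
    filter_upwards [h0, hreg] with ω h hω hmem
    have hsub : Ico (jumpTime q ω n) (jumpTime q ω (n + 1)) ⊆
        ((fun t => (t, ω)) ⁻¹' S) ∩ Ici 0 := fun t ht =>
      ⟨⟨ht, hmem⟩, le_trans (by simpa using hω.1.monotone (Nat.zero_le n)) ht.1⟩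
    have hle := measure_mono (μ := volume) hsub
    rw [← Measure.restrict_apply (measurable_prodMk_right hSm)] at hle
    rw [Pi.zero_apply] at h
    rw [h, Real.volume_Ico] at hle
    have := hω.1 n.lt_succ_self
    simp only [nonpos_iff_eq_zero, ENNReal.ofReal_eq_zero] at hle
    linarith
  refine hpos.trans_le ?_
  rw [Measure.prod_apply hSm]
  refine setLIntegral_mono_ae' measurableSet_Ici (ae_of_all _ fun t ht => ?_)
  refine measure_mono_ae ?_
  filter_upwards [hreg] with ω hω h
  have ht' : ((t.toNNReal : ℝ≥0) : ℝ) = t := Real.coe_toNNReal _ ht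
  change jumpProcess q t.toNNReal ω ∈ A
  rw [jumpProcess_eq hω (n := n) (by rw [ht']; exact h.1)]
  exact h.2

end Occupation

/-! ### Counting measures and the reference measure. -/

section Config

variable {E F : Type*} [MeasurableSpace E] [MeasurableSpace F]

/-- Finitely many evaluations determine `s`: equal multiplicities at the atoms of `s` give `s ≤ t`,
and equal total mass then forces equality. -/
instance [MeasurableSingletonClass E] : MeasurableSingletonClass (Config E) := ⟨fun s => by
  classical
  have h : ({s} : Set (Config E)) =
      {t | toMeasure t univ = toMeasure s univ} ∩
        ⋂ u ∈ s.toFinset, {t | toMeasure t {u} = toMeasure s {u}} := by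
    ext t
    simp only [mem_singleton_iff, mem_inter_iff, mem_ofPred_eq, mem_iInter, toMeasure_univ,
      toMeasure_singleton, Nat.cast_inj]
    constructor
    · rintro rfl; simp
    · rintro ⟨h1, h2⟩
      refine (Multiset.eq_of_le_of_card_le (Multiset.le_iff_count.2 fun u => ?_) h1.le).symm
      by_cases hu : u ∈ s
      · exact (h2 u (Multiset.mem_toFinset.2 hu)).ge
      · simp [Multiset.count_eq_zero_of_notMem hu]
  have hm (B : Set E) (hB : MeasurableSet B) (c : ℝ≥0∞) :
      MeasurableSet {t : Config E | toMeasure t B = c} :=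
    ((Measure.measurable_coe hB).comp measurable_toMeasure) (measurableSet_singleton c)
  rw [h]
  exact (hm _ MeasurableSet.univ _).inter (Finset.measurableSet_biInter _ fun u _ =>
    hm _ (measurableSet_singleton u) _)⟩

lemma measurable_map_config {f : E → F} (hf : Measurable f) :
    Measurable fun s : Config E => (s.map f : Config F) := by
  refine measurable_config_iff.2 fun B hB => ?_
  have h (s : Config E) : toMeasure (s.map f) B = toMeasure s (f ⁻¹' B) := by
    induction s using Multiset.induction_on with
    | empty => simp
    | cons u s ih =>
      simp only [Multiset.map_cons, toMeasure_cons, Measure.add_apply, ih,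
        Measure.dirac_apply' _ hB, Measure.dirac_apply' _ (hf hB)]
      rfl
  simp only [h]
  exact (Measure.measurable_coe (hf hB)).comp measurable_toMeasure

lemma measurable_config_of_fin (n : ℕ) :
    Measurable fun x : Fin n → E => (Finset.univ.val.map x : Config E) := by
  refine measurable_config_iff.2 fun B hB => ?_
  have h (x : Fin n → E) : toMeasure (Finset.univ.val.map x) B = ∑ i, B.indicator 1 (x i) := by
    have : toMeasure (Finset.univ.val.map x) = ∑ i, Measure.dirac (x i) := by
      rw [toMeasure, Multiset.map_map]; rfl
    rw [this, Measure.coe_finsetSum, Finset.sum_apply]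
    exact Finset.sum_congr rfl fun i _ => Measure.dirac_apply' _ hB
  simp only [h]
  exact Finset.measurable_sum _ fun i _ =>
    (measurable_one.indicator hB).comp (measurable_pi_apply i)

lemma measurableSet_oneInEach {n : ℕ} {B : Fin n → Set E} (hB : ∀ i, MeasurableSet (B i)) :
    MeasurableSet (oneInEach B) := by
  have hm (B : Set E) (hB : MeasurableSet B) : Measurable fun s : Config E => toMeasure s B :=
    (Measure.measurable_coe hB).comp measurable_toMeasure
  have h : oneInEach B = {s | toMeasure s univ = n} ∩ ⋂ i, {s | 0 < toMeasure s (B i)} := by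
    ext s; simp [oneInEach]
  rw [h]
  exact ((hm _ MeasurableSet.univ) (measurableSet_singleton _)).inter
    (MeasurableSet.iInter fun i => measurableSet_lt measurable_const (hm _ (hB i)))

lemma toMeasure_pos_iff (s : Config E) {B : Set E} (hB : MeasurableSet B) :
    0 < toMeasure s B ↔ ∃ x ∈ s, x ∈ B := by
  induction s using Multiset.induction_on with
  | empty => simp
  | cons u s ih =>
    rw [toMeasure_cons, Measure.add_apply, add_pos_iff, ih, Measure.dirac_apply' _ hB]
    by_cases hu : u ∈ B <;> simp [hu]

variable (m : Measure E)

lemma referenceMeasure_apply {A : Set (Config E)} (hA : MeasurableSet A) :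
    referenceMeasure m A = ∑' n : ℕ, ((2 : ℝ≥0∞)⁻¹ ^ n * (n.factorial : ℝ≥0∞)⁻¹) *
      (Measure.pi fun _ : Fin n => m).map (fun x => (Finset.univ.val.map x : Config E)) A := by
  rw [referenceMeasure, Measure.sum_apply _ hA]
  rfl

/-- When `n` points meet `n` disjoint sets, points and sets are matched by a unique permutation, so
the event is a disjoint union of `n!` boxes of equal measure. -/
lemma pi_setOf_forall_exists_mem [SigmaFinite m] {n : ℕ} {B : Fin n → Set E}
    (hB : ∀ i, MeasurableSet (B i)) (hd : Pairwise (Function.onFun Disjoint B)) :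
    (Measure.pi fun _ : Fin n => m) {x | ∀ i, ∃ j, x j ∈ B i} = n.factorial * ∏ i, m (B i) := by
  have huniq {y : E} {i i' : Fin n} (h : y ∈ B i) (h' : y ∈ B i') : i = i' := by
    by_contra hne
    exact disjoint_left.1 (hd hne) h h'
  have hset : {x : Fin n → E | ∀ i, ∃ j, x j ∈ B i} =
      ⋃ σ : Equiv.Perm (Fin n), univ.pi fun j => B (σ j) := by
    ext x
    simp only [mem_ofPred_eq, mem_iUnion, mem_univ_pi]
    constructor
    · intro h
      choose j hj using h
      have hinj : Function.Injective j := fun i i' hii => huniq (hj i) (hii ▸ hj i')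
      let τ : Equiv.Perm (Fin n) := Equiv.ofBijective j (Finite.injective_iff_bijective.1 hinj)
      refine ⟨τ.symm, fun k => ?_⟩
      have := hj (τ.symm k)
      rwa [show j (τ.symm k) = k from τ.apply_symm_apply k] at this
    · rintro ⟨σ, hσ⟩ i
      exact ⟨σ.symm i, by simpa using hσ (σ.symm i)⟩
  rw [hset, measure_iUnion, tsum_fintype]
  · have (σ : Equiv.Perm (Fin n)) :
        (Measure.pi fun _ : Fin n => m) (univ.pi fun j => B (σ j)) = ∏ i, m (B i) := by
      rw [Measure.pi_pi]
      exact Equiv.prod_comp σ fun i => m (B i)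
    simp [this, Fintype.card_perm]
  · intro σ τ hne
    refine disjoint_left.2 fun x hx hx' => hne (Equiv.ext fun j => ?_)
    exact huniq (hx j (mem_univ j)) (hx' j (mem_univ j))
  · exact fun σ => MeasurableSet.univ_pi fun j => hB _

/-- The total mass selects the `n`-th term of the series, and its factor `1 / n!` cancels the number
of matchings. -/
theorem referenceMeasure_oneInEach [SigmaFinite m] {n : ℕ} {B : Fin n → Set E}
    (hB : ∀ i, MeasurableSet (B i)) (hd : Pairwise (Function.onFun Disjoint B)) :
    referenceMeasure m (oneInEach B) = (2 : ℝ≥0∞)⁻¹ ^ n * ∏ i, m (B i) := by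
  have hm := measurableSet_oneInEach hB
  rw [referenceMeasure_apply m hm, tsum_eq_single n]
  · have hpre : (fun x : Fin n → E => (Finset.univ.val.map x : Config E)) ⁻¹' oneInEach B =
        {x | ∀ i, ∃ j, x j ∈ B i} := by
      ext x
      simp [oneInEach, toMeasure_univ, toMeasure_pos_iff _ (hB _)]
    rw [Measure.map_apply (measurable_config_of_fin n) hm, hpre, pi_setOf_forall_exists_mem m hB hd,
      mul_assoc, ← mul_assoc (_⁻¹ : ℝ≥0∞), ENNReal.inv_mul_cancel, one_mul]
    · exact_mod_cast n.factorial_ne_zero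
    · exact ENNReal.natCast_ne_top _
  · intro k hk
    have hpre : (fun x : Fin k → E => (Finset.univ.val.map x : Config E)) ⁻¹' oneInEach B = ∅ := by
      ext x
      simp [oneInEach, toMeasure_univ, hk]
    rw [Measure.map_apply (measurable_config_of_fin k) hm, hpre, measure_empty, mul_zero]

theorem referenceMeasure_singleton_zero [SigmaFinite m] :
    referenceMeasure m {(0 : Config E)} = 1 := by
  have h := referenceMeasure_oneInEach m (n := 0) (B := fun i => i.elim0) (fun i => i.elim0)
    (fun i => i.elim0)
  have hset : oneInEach (fun i : Fin 0 => (i.elim0 : Set E)) = {(0 : Config E)} := by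
    ext s
    simp [oneInEach, toMeasure_univ]
  rw [hset] at h
  simpa using h

theorem referenceMeasure_map [SigmaFinite m] {f : E → F} (hf : Measurable f)
    [SigmaFinite (m.map f)] :
    (referenceMeasure m).map (fun s => (s.map f : Config F)) = referenceMeasure (m.map f) := by
  rw [referenceMeasure, Measure.map_sum (measurable_map_config hf).aemeasurable, referenceMeasure]
  congr 1
  funext n
  rw [Measure.map_smul, ← Measure.pi_map_pi fun _ => hf.aemeasurable,
    Measure.map_map (measurable_map_config hf) (measurable_config_of_fin n),
    Measure.map_map (measurable_config_of_fin n) (by fun_prop)]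
  congr 2
  funext x
  exact Multiset.map_map f x Finset.univ.val

/-- If a kernel on configurations adds a point with law at least equivalent to `m` at every step,
then `n` independent points of law `m` form a configuration whose law is absolutely continuous with
respect to the `n`-th step of the chain started from the empty configuration. -/
theorem map_pi_absolutelyContinuous_pow [SigmaFinite m] (κ : Kernel (Config E) (Config E))
    (hκ : ∀ s A, MeasurableSet A → κ s A = 0 → m {u | u ::ₘ s ∈ A} = 0) (n : ℕ) :
    (Measure.pi fun _ : Fin n => m).map (fun x => (Finset.univ.val.map x : Config E)) ≪
      (κ ^ n) 0 := by
  induction n with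
  | zero =>
    refine Measure.AbsolutelyContinuous.mk fun A hA h => ?_
    rw [pow_zero] at h
    have h0 : (0 : Config E) ∉ A := by
      have h' : Measure.dirac (0 : Config E) A = 0 := h
      rw [Measure.dirac_apply' _ hA] at h'
      intro h0
      simp [h0] at h'
    rw [Measure.map_apply (measurable_config_of_fin 0) hA]
    convert measure_empty (μ := Measure.pi fun _ : Fin 0 => m)
    ext x
    simpa using h0
  | succ n ih =>
    refine Measure.AbsolutelyContinuous.mk fun A hA h => ?_
    rw [Kernel.pow_succ_apply_eq_lintegral κ n 0 hA,
      lintegral_eq_zero_iff (κ.measurable_coe hA)] at h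
    -- A set null for step `n + 1` is null for one further step from almost every state at time `n`;
    -- by induction this holds from almost every `n`-tuple.
    have h2 : ∀ᵐ x ∂(Measure.pi fun _ : Fin n => m),
        κ (Finset.univ.val.map x : Config E) A = 0 :=
      ae_of_ae_map (measurable_config_of_fin n).aemeasurable (ih.ae_le h)
    -- The added point is taken as coordinate `0`, the order being invisible in the multiset. Fubini
    -- then integrates over it with the other `n` points fixed.
    have hmp := measurePreserving_piFinSuccAbove (fun _ : Fin (n + 1) => m) 0
    have hcons (p : E × (Fin n → E)) : (Finset.univ.val.map
        ((MeasurableEquiv.piFinSuccAbove (fun _ : Fin (n + 1) => E) 0).symm p) : Config E) =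
          p.1 ::ₘ Finset.univ.val.map p.2 := by
      rw [Fin.univ_val_map, Fin.univ_val_map, List.ofFn_succ, ← Multiset.cons_coe]
      rfl
    have hset : MeasurableSet {p : E × (Fin n → E) |
        (p.1 ::ₘ (Finset.univ.val.map p.2 : Config E)) ∈ A} :=
      (measurable_cons.comp (measurable_fst.prodMk
        ((measurable_config_of_fin n).comp measurable_snd))) hA
    rw [Measure.map_apply (measurable_config_of_fin (n + 1)) hA, ← hmp.symm.measure_preimage_equiv]
    have : (MeasurableEquiv.piFinSuccAbove (fun _ : Fin (n + 1) => E) 0).symm ⁻¹'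
        ((fun x => (Finset.univ.val.map x : Config E)) ⁻¹' A) =
        {p : E × (Fin n → E) | (p.1 ::ₘ (Finset.univ.val.map p.2 : Config E)) ∈ A} := by
      ext p
      simp only [mem_preimage, hcons, mem_ofPred_eq]
    rw [this, Measure.prod_apply_symm hset, lintegral_eq_zero_iff
      (measurable_measure_prodMk_right hset)]
    filter_upwards [h2] with x hx
    exact hκ _ A hA hx

end Config

/-! ### The network: rate bounds, non-explosion, reachability. -/

namespace Network

variable {K : ℕ} (N : Network K)

lemma measurable_transmitter : Measurable N.transmitter :=
  measurable_snd.comp (measurable_subtype_coe.comp measurable_fst)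

lemma measurable_transmitters : Measurable N.transmitters :=
  measurable_map_config N.measurable_transmitter

lemma userMeasure_map_transmitter (H : Measure (Torus N.side)) [SFinite H] :
    (N.userMeasure H).map N.transmitter = H := by
  rw [userMeasure, Measure.map_map N.measurable_transmitter N.measurable_mkUser]
  change (H.prod _).map Prod.fst = H
  rw [Measure.map_fst_prod, measure_univ, one_smul]

lemma userMeasure_absolutelyContinuous {H H' : Measure (Torus N.side)} [SFinite H] [SFinite H']
    (h : H ≪ H') : N.userMeasure H ≪ N.userMeasure H' :=
  (h.prod Measure.AbsolutelyContinuous.rfl).map N.measurable_mkUser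

open scoped Classical in
lemma rateKernel_apply (s : Config N.User) {A : Set (Config N.User)} (hA : MeasurableSet A) :
    N.rateKernel s A = N.arrivalRate * N.userMeasure volume {u | u ::ₘ s ∈ A} +
      (s.map fun u => (N.deathRate u (s.erase u) : ℝ≥0∞) * A.indicator 1 (s.erase u)).sum := by
  change (Measure.map _ _ + _ : Measure _) A = _
  rw [Measure.add_apply, sum_smul_dirac_apply _ _ _ hA,
    Measure.map_apply (measurable_cons_right s) hA]
  rfl

/-- The numerator is positive because classes are nonempty and the path loss at the link length is
positive. -/
lemma deathRate_pos (u : N.User) (s : Config N.User) : 0 < N.deathRate u s := by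
  have h1 : (0 : ℝ≥0) < u.2.1.card := by exact_mod_cast Finset.card_pos.2 u.2.2
  exact div_pos (div_pos (mul_pos h1 N.pathLoss_linkLength_pos)
    (add_pos_of_pos_of_nonneg N.noise_pos zero_le)) (N.meanFile_pos _)

/-- A bound for the departure rates. -/
def maxDeathRate : ℝ≥0 :=
  ∑ C : Class K, C.1.card * N.pathLoss N.linkLength / N.noise / N.meanFile C

/-- Dropping the interference increases the rate; the sum over the finitely many classes serves as a
bound uniform in the class. -/
lemma deathRate_le (u : N.User) (s : Config N.User) : N.deathRate u s ≤ N.maxDeathRate := by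
  refine le_trans ?_ (Finset.single_le_sum (f := fun C : Class K =>
    C.1.card * N.pathLoss N.linkLength / N.noise / N.meanFile C) (fun _ _ => zero_le)
    (Finset.mem_univ u.2))
  unfold deathRate
  have := N.noise_pos
  gcongr
  exact le_self_add

lemma rateKernel_univ_le (s : Config N.User) : N.rateKernel s univ ≤
    N.arrivalRate * (volume : Measure (Torus N.side)) univ + s.card * N.maxDeathRate := by
  classical
  rw [N.rateKernel_apply s MeasurableSet.univ]
  gcongr
  · rw [← userMeasure_univ]
    exact measure_mono (subset_univ _)
  · refine (Multiset.sum_le_card_nsmul _ (N.maxDeathRate : ℝ≥0∞) fun x hx => ?_).trans ?_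
    · obtain ⟨u, -, rfl⟩ := Multiset.mem_map.1 hx
      simpa using N.deathRate_le u _
    · simp

lemma jumpKernel_eq_zero_iff (s : Config N.User) (A : Set (Config N.User)) :
    jumpKernel N.rateKernel s A = 0 ↔ N.rateKernel s A = 0 := by
  change (N.rateKernel s univ)⁻¹ * N.rateKernel s A = 0 ↔ _
  simp [IsPosFiniteRate.finite (q := N.rateKernel) s]

lemma measurableSet_card_gt (n : ℕ) : MeasurableSet {s : Config N.User | n < s.card} :=
  measurableSet_lt measurable_const measurable_card

/-- A jump adds at most one user. The first step is the one split off, and the induction hypothesis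
is used from the random state it leads to. -/
lemma jumpKernel_pow_card_gt (k : ℕ) : ∀ s : Config N.User,
    (jumpKernel N.rateKernel ^ k) s {t | s.card + k < t.card} = 0 := by
  classical
  induction k with
  | zero =>
    intro s
    rw [pow_zero]
    change Measure.dirac s _ = 0
    rw [Measure.dirac_apply' _ (N.measurableSet_card_gt _)]
    simp
  | succ k ih =>
    intro s
    have hm := N.measurableSet_card_gt (s.card + (1 + k))
    rw [add_comm k 1]
    have hstep : ∀ᵐ t ∂jumpKernel N.rateKernel s, t.card ≤ s.card + 1 := by
      rw [ae_iff, N.jumpKernel_eq_zero_iff]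
      simp only [not_le]
      rw [N.rateKernel_apply s (N.measurableSet_card_gt _)]
      have h1 : {u : N.User | u ::ₘ s ∈ {t : Config N.User | s.card + 1 < t.card}} = ∅ := by
        ext u; simp
      rw [h1, measure_empty, mul_zero, zero_add, Multiset.sum_eq_zero]
      intro x hx
      obtain ⟨u, -, rfl⟩ := Multiset.mem_map.1 hx
      rw [indicator_of_notMem, mul_zero]
      have := Multiset.card_le_card (Multiset.erase_le u s)
      simp only [mem_ofPred_eq]
      omega
    rw [Kernel.pow_add_apply_eq_lintegral _ 1 k s hm, pow_one, lintegral_eq_zero_iff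
      (Kernel.measurable_coe _ hm)]
    filter_upwards [hstep] with t ht
    refine measure_mono_null (fun r hr => ?_) (ih t)
    simp only [mem_ofPred_eq] at hr ⊢
    omega

theorem ae_isRegularPath (s : Config N.User) :
    ∀ᵐ ω ∂pathLaw N.rateKernel s, IsRegularPath N.rateKernel ω := by
  set a : ℝ≥0∞ := N.arrivalRate * (volume : Measure (Torus N.side)) univ with ha
  have ha' : a ≠ ∞ := ENNReal.mul_ne_top ENNReal.coe_ne_top (measure_ne_top _ _)
  -- After `k` jumps there are at most `card s + k ≤ (card s + 1) * (k + 1)` users, and the arrival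
  -- rate `a` is at most `a * (k + 1)`.
  refine SBD.ae_isRegularPath _ s (a.toReal + (s.card + 1) * N.maxDeathRate) ?_
  rw [ae_all_iff]
  intro k
  have h := chainLaw_eval (jumpKernel N.rateKernel) k (N.measurableSet_card_gt (s.card + k)) s
  rw [N.jumpKernel_pow_card_gt k s] at h
  filter_upwards [measure_eq_zero_iff_ae_notMem.1 h] with ω hω
  have hc : ((ω k).card : ℝ) ≤ s.card + k := by
    have : (ω k).card ≤ s.card + k := by simpa using hω
    exact_mod_cast this
  have hle := ENNReal.toReal_mono (ENNReal.add_ne_top.2 ⟨ha', ENNReal.mul_ne_top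
    (ENNReal.natCast_ne_top _) ENNReal.coe_ne_top⟩) (N.rateKernel_univ_le (ω k))
  rw [ENNReal.toReal_add ha' (ENNReal.mul_ne_top (ENNReal.natCast_ne_top _) ENNReal.coe_ne_top),
    ENNReal.toReal_mul (a := ((ω k).card : ℝ≥0∞)), ENNReal.toReal_natCast,
    ENNReal.coe_toReal] at hle
  have h1 : 0 ≤ a.toReal := ENNReal.toReal_nonneg
  have h2 : (0 : ℝ) ≤ N.maxDeathRate := NNReal.coe_nonneg _
  have h3 : (0 : ℝ) ≤ k := Nat.cast_nonneg k
  have h4 : (0 : ℝ) ≤ s.card := Nat.cast_nonneg _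
  calc (N.rateKernel (ω k) univ).toReal ≤ a.toReal + (ω k).card * N.maxDeathRate := hle
    _ ≤ a.toReal + (s.card + k) * N.maxDeathRate := by gcongr
    _ ≤ a.toReal * (k + 1) + (s.card + 1) * (k + 1) * N.maxDeathRate := by
      refine add_le_add (le_mul_of_one_le_right h1 (by linarith)) ?_
      refine mul_le_mul_of_nonneg_right ?_ h2
      nlinarith
    _ = _ := by ring

/-- The empty configuration is reached from `s` in `card s` steps, by departures only. -/
theorem jumpKernel_pow_zero_pos (n : ℕ) : ∀ s : Config N.User, s.card = n →
    0 < (jumpKernel N.rateKernel ^ n) s {0} := by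
  classical
  induction n with
  | zero =>
    intro s hs
    rw [pow_zero, Multiset.card_eq_zero.1 hs]
    change 0 < Measure.dirac (0 : Config N.User) {0}
    simp
  | succ n ih =>
    intro s hs
    obtain ⟨u, hu⟩ := Multiset.card_pos_iff_exists_mem.1 (by omega : 0 < s.card)
    obtain ⟨t, rfl⟩ := Multiset.exists_cons_of_mem hu
    have ht : t.card = n := by simpa using hs
    rw [add_comm, Kernel.pow_add_apply_eq_lintegral _ 1 n _ (measurableSet_singleton _), pow_one]
    -- The departure of `u` gives the single state `t` positive mass, so the integral over the next
    -- state may be bounded below by this atom.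
    have hstep : jumpKernel N.rateKernel (u ::ₘ t) {t} ≠ 0 := by
      rw [Ne, N.jumpKernel_eq_zero_iff, N.rateKernel_apply _ (measurableSet_singleton _)]
      simp [(N.deathRate_pos u t).ne']
    refine lt_of_lt_of_le ?_ (setLIntegral_le_lintegral {t} _)
    rw [lintegral_singleton]
    exact ENNReal.mul_pos (ih t ht).ne' hstep

/-- Allows the arrival intensity, which is driven by `volume`, to be compared with an arbitrary Haar
measure `H`. -/
instance : (volume : Measure (Torus N.side)).IsAddHaarMeasure :=
  inferInstanceAs ((volume : Measure (AddCircle N.side)).prod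
    (volume : Measure (AddCircle N.side))).IsAddHaarMeasure

variable (H : Measure (Torus N.side)) [H.IsAddHaarMeasure]

/-- The jump chain reaches every set of positive reference measure, through the empty
configuration. -/
theorem exists_jumpKernel_pow_pos {A : Set (Config N.User)} (hA : MeasurableSet A)
    (hpos : 0 < referenceMeasure (N.userMeasure H) A) (s : Config N.User) :
    ∃ n, 0 < (jumpKernel N.rateKernel ^ n) s A := by
  rw [referenceMeasure_apply _ hA, pos_iff_ne_zero, Ne, ENNReal.tsum_eq_zero, not_forall] at hpos
  obtain ⟨n, hn⟩ := hpos
  have hac := map_pi_absolutelyContinuous_pow (N.userMeasure H) (jumpKernel N.rateKernel)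
    -- A set with zero jump rate has zero arrival rate; as `λ > 0`, it is missed by users placed
    -- according to `volume`, hence also by those placed according to `H`.
    (fun s A hA h => by
      rw [N.jumpKernel_eq_zero_iff, N.rateKernel_apply s hA] at h
      have h0 : N.userMeasure volume {u | u ::ₘ s ∈ A} = 0 := by
        simpa [N.arrivalRate_pos.ne'] using (add_eq_zero.1 h).1
      exact N.userMeasure_absolutelyContinuous
        (Measure.absolutelyContinuous_isAddHaarMeasure H volume) h0) n
  have h0 : (jumpKernel N.rateKernel ^ n) 0 A ≠ 0 := fun h => hn (by rw [hac h, mul_zero])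
  -- First `card s` departures down to the empty state, then `n` births, where `n` is the index of a
  -- term of the reference measure that charges `A`.
  refine ⟨s.card + n, ?_⟩
  rw [Kernel.pow_add_apply_eq_lintegral _ s.card n s hA]
  refine lt_of_lt_of_le ?_ (setLIntegral_le_lintegral {0} _)
  rw [lintegral_singleton]
  exact ENNReal.mul_pos h0 (N.jumpKernel_pow_zero_pos _ s rfl).ne'

end Network

end SBD

end

theorem mainTheorem9 {K : ℕ} (N : Network K)
    (H : Measure (Torus N.side)) [H.IsAddHaarMeasure] :
    -- the dynamics does not explode and defines a Markov jump process
    (∀ s, ∀ᵐ ω ∂pathLaw N.rateKernel s, StrictMono (jumpTime N.rateKernel ω) ∧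
      Tendsto (jumpTime N.rateKernel ω) atTop atTop) ∧
    IsMarkovJumpProcess (pathLaw N.rateKernel) (jumpProcess N.rateKernel) ∧
    -- the reference measure on counting measures on the torus, and its lift to users
    (referenceMeasure H {0} = 1 ∧
      ∀ (n : ℕ) (B : Fin n → Set (Torus N.side)), (∀ i, MeasurableSet (B i)) →
        Pairwise (Function.onFun Disjoint B) →
        referenceMeasure H (oneInEach B) = (2 : ℝ≥0∞)⁻¹ ^ n * ∏ i, H (B i)) ∧
    (referenceMeasure (N.userMeasure H)).map N.transmitters = referenceMeasure H ∧
    -- irreducibility of the process: on the space of configurations of users, and on the torus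
    IsPhiIrreducible (pathLaw N.rateKernel) (jumpProcess N.rateKernel)
      (referenceMeasure (N.userMeasure H)) ∧
    IsPhiIrreducible (pathLaw N.rateKernel)
      (fun t ω => N.transmitters (jumpProcess N.rateKernel t ω)) (referenceMeasure H) ∧
    -- irreducibility of the jump chain, through the empty configuration
    (jumpKernel N.rateKernel).IsIrreducible (referenceMeasure (N.userMeasure H)) ∧
    (∀ A : Set (Config (Torus N.side)), MeasurableSet A → 0 < referenceMeasure H A →
      ∀ s, ∃ n : ℕ, 0 < (jumpKernel N.rateKernel ^ n) s (N.transmitters ⁻¹' A)) ∧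
    (∀ s, ∃ n : ℕ, 0 < (jumpKernel N.rateKernel ^ n) s {0}) := by

  have hmap : (referenceMeasure (N.userMeasure H)).map N.transmitters = referenceMeasure H := by
    have hH := N.userMeasure_map_transmitter H
    have : SigmaFinite ((N.userMeasure H).map N.transmitter) := by rw [hH]; infer_instance
    have h := referenceMeasure_map (N.userMeasure H) N.measurable_transmitter
    rwa [hH] at h
  -- Since `ψ` projects to `φ`, each statement about transmitters is the statement about users for
  -- the preimage of `A`.
  have hlift (A : Set (Config (Torus N.side))) (hA : MeasurableSet A)
      (hpos : 0 < referenceMeasure H A) :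
      0 < referenceMeasure (N.userMeasure H) (N.transmitters ⁻¹' A) := by
    rwa [← hmap, Measure.map_apply N.measurable_transmitters hA] at hpos
  have hirr : IsPhiIrreducible (pathLaw N.rateKernel) (jumpProcess N.rateKernel)
      (referenceMeasure (N.userMeasure H)) := fun A hA hpos s => by
    obtain ⟨n, hn⟩ := N.exists_jumpKernel_pow_pos H hA hpos s
    exact occupation_pos_of_jumpKernel_pow_pos _ (N.ae_isRegularPath s) hA hn
  exact ⟨N.ae_isRegularPath, isMarkovJumpProcess_of_regular _ N.ae_isRegularPath,
    ⟨referenceMeasure_singleton_zero H, fun _ _ hB hd => referenceMeasure_oneInEach H hB hd⟩,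
    hmap, hirr, fun A hA hpos => hirr _ (N.measurable_transmitters hA) (hlift A hA hpos),
    ⟨fun A hA hpos s => N.exists_jumpKernel_pow_pos H hA hpos s⟩,
    fun A hA hpos s => N.exists_jumpKernel_pow_pos H (N.measurable_transmitters hA)
      (hlift A hA hpos) s,
    fun s => ⟨_, N.jumpKernel_pow_zero_pos _ s rfl⟩⟩
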